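/- Let $k$ be an algebraically closed field of characteristic zero and $G$ a finite group. Group actions on varieties are right actions over $k$. For a finite-dimensional representation $V$ of a group $H$, let $\mathbb P(V^\vee)=\operatorname{Proj}(\operatorname{Sym} V)$ be the projective space of lines in $V^\vee$, with the induced right $H$-action. A variety $X$ with $H$-action is called $H$-unirational if there are a finite-dimensional representation $V$ of $H$ and a dominant $H$-equivariant rational map $\mathbb P(V^\vee)\dashrightarrow X$ over $k$. A $G$-action on $X$ is called projectively unirational if there is a central extension $1\to \widetilde Z\to\widetilde G\to G\to 1$ with $\widetilde Z$ finite cyclic, such that $X$ is $\widetilde G$-unirational, where $\widetilde G$ acts through $\widetilde G\to G$. For each $\gamma\in \mathrm H^2(G,k^\times)$ (trivial action on $k^\times$), fix - a central extension $1\to Z_\gamma\to \widehat G_\gamma\to G\to 1$ with $Z_\gamma$ finite cyclic, together with an isomorphism $\chi_\gamma\colon Z_\gamma\cong\langle\zeta_\gamma\rangle\subset k^\times$, where $\zeta_\gamma$ is a primitive $|Z_\gamma|$-th root of unity, whose class is $\gamma$; that is, for a set-theoretic section $s$ of $\widehat G_\gamma\to G$, the class $\gamma$ is represented by the cocycle $(g,h)\mapsto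 \chi_\gamma(s(g)s(h)s(gh)^{-1})$; - a finite-dimensional representation $W_\gamma\neq 0$ of $\widehat G_\gamma$ such that the subgroup of $\widehat G_\gamma$ acting on $W_\gamma$ by scalars is exactly $Z_\gamma$, acting by the character $\chi_\gamma$. Hence, for every $m$, the action of $\widehat G_\gamma$ on $\mathbb P((W_\gamma^{m})^\vee)$ descends to an action of $G$. Then the group $\mathrm H^2(G,k^\times)$ is finite, and for every smooth projective rational variety $X$ over $k$ with a regular action of $G$ the following are equivalent: (i) the $G$-action on $X$ is projectively unirational; (ii) $X$ is $\widehat G_\gamma$-unirational for some $\gamma\in \mathrm H^2(G,k^\times)$, where $\widehat G_\gamma$ acts through $\widehat G_\gamma\to G$; (iii) for some $\gamma\in \mathrm H^2(G,k^\times)$ and some positive integer $m$ there is a dominant $G$-equivariant rational map $\mathbb P((W_\gamma^{m})^\vee)\dashrightarrow X$ over $k$. -/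

import Mathlib

open CategoryTheory AlgebraicGeometry

universe u

noncomputable section

/-! ### Projectivization of a vector space -/

namespace SymProj

section Grading

variable (k : Type u) [Field k] (V : Type u) [AddCommGroup V] [Module k V]

/-- The degree `n` part `Symⁿ V` of the symmetric algebra: the `k`-span of the `n`-fold products
of elements of `V`. -/
def grading (n : ℕ) : Submodule k (SymmetricAlgebra k V) :=
  LinearMap.range (SymmetricAlgebra.ι k V) ^ n

theorem ι_mem_grading_one (v : V) : SymmetricAlgebra.ι k V v ∈ grading k V 1 := by
  simp [grading]

instance : SetLike.GradedMonoid (grading k V) :=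
  inferInstanceAs
    (SetLike.GradedMonoid fun n : ℕ => LinearMap.range (SymmetricAlgebra.ι k V) ^ n)

open scoped DirectSum in
/-- The inclusion of `V` as the degree one part; auxiliary for the grading of `Sym V`. -/
def gradedι : V →ₗ[k] ⨁ i : ℕ, grading k V i :=
  DirectSum.lof k ℕ (fun i => grading k V i) 1 ∘ₗ
    (SymmetricAlgebra.ι k V).codRestrict _ fun v => ι_mem_grading_one k V v

/-- `Sym V` is graded by the submodules `Symⁿ V`. -/
instance : GradedAlgebra (grading k V) :=
  GradedAlgebra.ofAlgHom _ (SymmetricAlgebra.lift (gradedι k V))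
    (by
      apply SymmetricAlgebra.algHom_ext
      ext v
      simp [gradedι, DirectSum.lof_eq_of])
    fun i x => by
    obtain ⟨x, hx⟩ := x
    dsimp only [Subtype.coe_mk, DirectSum.lof_eq_of]
    change x ∈ LinearMap.range (SymmetricAlgebra.ι k V) ^ i at hx
    induction hx using Submodule.pow_induction_on_left' with
    | algebraMap r =>
      rw [AlgHom.commutes, DirectSum.algebraMap_apply]; rfl
    | add x y i hx hy ihx ihy =>
      rw [map_add, ihx, ihy, ← map_add]
      rfl
    | mem_mul m hm i x hx ih =>
      obtain ⟨_, rfl⟩ := hm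
      rw [map_mul, ih, SymmetricAlgebra.lift_ι_apply]
      simp only [gradedι, LinearMap.comp_apply, DirectSum.lof_eq_of]
      rw [DirectSum.of_mul_of]
      exact DirectSum.of_eq_of_gradedMonoid_eq (Sigma.subtype_ext (add_comm _ _) rfl)

end Grading

variable {k : Type u} [Field k] {V : Type u} [AddCommGroup V] [Module k V]

theorem lift_mem (f : V →ₗ[k] V) (n : ℕ) (x : SymmetricAlgebra k V) (hx : x ∈ grading k V n) :
    SymmetricAlgebra.lift (SymmetricAlgebra.ι k V ∘ₗ f) x ∈ grading k V n := by
  change x ∈ LinearMap.range (SymmetricAlgebra.ι k V) ^ n at hx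
  have h : Submodule.map (SymmetricAlgebra.lift (SymmetricAlgebra.ι k V ∘ₗ f)).toLinearMap
      (LinearMap.range (SymmetricAlgebra.ι k V) ^ n) ≤ grading k V n := by
    rw [Submodule.map_pow]
    refine pow_le_pow_left' ?_ n
    rintro _ ⟨_, ⟨v, rfl⟩, rfl⟩
    exact ⟨f v, by simp⟩
  exact h ⟨x, hx, rfl⟩

/-- The graded ring endomorphism `Sym(f)` of `Sym V` induced by a linear endomorphism `f`. -/
def symMap (f : V →ₗ[k] V) : GradedRingHom (grading k V) (grading k V) where
  toRingHom := (SymmetricAlgebra.lift (SymmetricAlgebra.ι k V ∘ₗ f)).toRingHom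
  map_mem := fun {i x} hx => lift_mem f i x hx

@[simp]
theorem symMap_ι (f : V →ₗ[k] V) (v : V) :
    symMap f (SymmetricAlgebra.ι k V v) = SymmetricAlgebra.ι k V (f v) :=
  SymmetricAlgebra.lift_ι_apply (f := SymmetricAlgebra.ι k V ∘ₗ f) v

@[simp]
theorem symMap_algebraMap (f : V →ₗ[k] V) (c : k) :
    symMap f (algebraMap k (SymmetricAlgebra k V) c) = algebraMap k _ c :=
  (SymmetricAlgebra.lift (SymmetricAlgebra.ι k V ∘ₗ f)).commutes c

theorem symMap_id : symMap (LinearMap.id : V →ₗ[k] V) = GradedRingHom.id (grading k V) := by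
  ext x
  exact congrArg (fun F : SymmetricAlgebra k V →ₐ[k] SymmetricAlgebra k V => F x)
    (SymmetricAlgebra.lift_ι (R := k) (M := V))

theorem symMap_comp (f g : V →ₗ[k] V) : symMap (f ∘ₗ g) = (symMap f).comp (symMap g) := by
  ext x
  have h : SymmetricAlgebra.lift (SymmetricAlgebra.ι k V ∘ₗ (f ∘ₗ g)) =
      (SymmetricAlgebra.lift (SymmetricAlgebra.ι k V ∘ₗ f)).comp
        (SymmetricAlgebra.lift (SymmetricAlgebra.ι k V ∘ₗ g)) := by
    apply SymmetricAlgebra.algHom_ext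
    ext v
    simp
  exact congrArg (fun F : SymmetricAlgebra k V →ₐ[k] SymmetricAlgebra k V => F x) h

theorem irrelevant_le (f g : V →ₗ[k] V) (h : f ∘ₗ g = LinearMap.id) :
    HomogeneousIdeal.irrelevant (grading k V) ≤
      (HomogeneousIdeal.irrelevant (grading k V)).map (symMap f) := by
  intro x hx
  have hx' : symMap g x ∈ HomogeneousIdeal.irrelevant (grading k V) := by
    rw [HomogeneousIdeal.mem_irrelevant_iff] at hx ⊢
    simp only [GradedRing.proj_apply] at hx ⊢
    rw [← GradedRingHom.map_directSumDecompose, hx, map_zero]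
  have hy : symMap f (symMap g x) = x := by
    rw [← GradedRingHom.comp_apply, ← symMap_comp, h, symMap_id, GradedRingHom.id_apply]
  rw [← hy]
  exact Ideal.mem_map_of_mem _ hx'

end SymProj

/-- The projective space `ℙ(V^∨) = Proj (Sym V)` of lines in the dual space of `V`. -/
abbrev ProjDual (k : Type u) [Field k] (V : Type u) [AddCommGroup V] [Module k V] : Scheme.{u} :=
  Proj (SymProj.grading k V)

namespace ProjDual

variable (k : Type u) [Field k] (V : Type u) [AddCommGroup V] [Module k V]

/-- The structure morphism `ℙ(V^∨) ⟶ Spec k`. -/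
instance : (ProjDual k V).Over (Spec (.of k)) where
  hom := Proj.toSpecZero (SymProj.grading k V) ≫
    Spec.map (CommRingCat.ofHom (algebraMap k (SymProj.grading k V 0)))

variable {k V}

/-- The automorphism of `ℙ(V^∨)` induced by a linear automorphism of `V`, by functoriality
of `Proj`. -/
def autOfInverse (f g : V →ₗ[k] V) (hfg : f ∘ₗ g = LinearMap.id) (hgf : g ∘ₗ f = LinearMap.id) :
    ProjDual k V ≅ ProjDual k V where
  hom := Proj.map (SymProj.symMap f) (SymProj.irrelevant_le f g hfg)
  inv := Proj.map (SymProj.symMap g) (SymProj.irrelevant_le g f hgf)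
  hom_inv_id := by
    rw [← Proj.map_comp]
    simp only [← SymProj.symMap_comp, hfg, SymProj.symMap_id]
    exact Proj.map_id
  inv_hom_id := by
    rw [← Proj.map_comp]
    simp only [← SymProj.symMap_comp, hgf, SymProj.symMap_id]
    exact Proj.map_id

theorem hom_ext_away {Y : Scheme.{u}} (f : V →ₗ[k] V)
    (hf : HomogeneousIdeal.irrelevant (SymProj.grading k V) ≤
      (HomogeneousIdeal.irrelevant (SymProj.grading k V)).map (SymProj.symMap f))
    (a b : ProjDual k V ⟶ Y)
    (h : ∀ (i : ℕ) (hi : 0 < i) (s : SymmetricAlgebra k V) (hs : s ∈ SymProj.grading k V i),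
      Proj.awayι _ (SymProj.symMap f s) ((SymProj.symMap f).map_mem hs) hi ≫ a =
        Proj.awayι _ (SymProj.symMap f s) ((SymProj.symMap f).map_mem hs) hi ≫ b) : a = b :=
  (Proj.mapAffineOpenCover _ hf).openCover.hom_ext _ _ fun s ↦ h s.1 s.1.2 s.2 s.2.2

theorem map_over (f : V →ₗ[k] V) (hf) :
    (Proj.map (SymProj.symMap f) hf : ProjDual k V ⟶ ProjDual k V) ≫
      (ProjDual k V ↘ Spec (.of k)) = ProjDual k V ↘ Spec (.of k) := by
  refine hom_ext_away f hf _ _ fun i hi s hs ↦ ?_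
  change Proj.awayι _ (SymProj.symMap f s) _ hi ≫ Proj.map _ _ ≫ Proj.toSpecZero _ ≫ _ =
    Proj.awayι _ (SymProj.symMap f s) _ hi ≫ Proj.toSpecZero _ ≫ _
  rw [Proj.awayι_comp_map_assoc _ _ hi _ hs, Proj.awayι_toSpecZero_assoc,
    Proj.awayι_toSpecZero_assoc]
  simp only [← Spec.map_comp, ← CommRingCat.ofHom_comp]
  congr 2
  ext c
  change (HomogeneousLocalization.Away.map (SymProj.symMap f) s
    (HomogeneousLocalization.mk ⟨0, algebraMap k (SymProj.grading k V 0) c, 1, _⟩)).val =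
    (HomogeneousLocalization.mk ⟨0, algebraMap k (SymProj.grading k V 0) c, 1, _⟩).val
  rw [HomogeneousLocalization.Away.map, HomogeneousLocalization.map_mk,
    HomogeneousLocalization.val_mk, HomogeneousLocalization.val_mk]
  congr 1
  · exact SymProj.symMap_algebraMap f c
  · exact Subtype.ext (map_one (SymProj.symMap f))

theorem symMap_smul_id (c : k) (n : ℕ) (x : SymmetricAlgebra k V)
    (hx : x ∈ SymProj.grading k V n) :
    SymProj.symMap (c • LinearMap.id : V →ₗ[k] V) x = x * algebraMap k _ (c ^ n) := by
  change x ∈ LinearMap.range (SymmetricAlgebra.ι k V) ^ n at hx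
  induction hx using Submodule.pow_induction_on_left' with
  | algebraMap r => simp
  | add x y i hx hy ihx ihy => rw [map_add, ihx, ihy, add_mul]
  | mem_mul m hm i x hx ih =>
    obtain ⟨v, rfl⟩ := hm
    rw [map_mul, ih, SymProj.symMap_ι, LinearMap.smul_apply, LinearMap.id_apply, map_smul,
      Algebra.smul_def, map_pow, map_pow, pow_succ]
    ring

/-- Scalars act trivially on `ℙ(V^∨)`. -/
theorem map_smul_id (c : k) (hf) :
    (Proj.map (SymProj.symMap (c • LinearMap.id : V →ₗ[k] V)) hf : ProjDual k V ⟶ ProjDual k V) =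
      𝟙 _ := by
  refine hom_ext_away _ hf _ _ fun i hi s hs ↦ ?_
  have key := Proj.SpecMap_awayMap_awayι (SymProj.grading k V) hs hi
    (SetLike.algebraMap_mem_graded (SymProj.grading k V) (c ^ i)) (symMap_smul_id c i s hs)
  rw [Proj.awayι_comp_map _ _ hi _ hs, Category.comp_id]
  refine Eq.trans ?_ key
  congr 3
  ext x
  obtain ⟨n, x, hx, rfl⟩ := x.mk_surjective _ hs
  rw [HomogeneousLocalization.Away.map_mk, HomogeneousLocalization.awayMap_mk]
  simp only [HomogeneousLocalization.Away.val_mk]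
  congr 1
  rw [symMap_smul_id c _ x hx, ← map_pow, ← pow_mul, smul_eq_mul, mul_comm n]

end ProjDual

/-! ### Right actions and equivariant rational maps -/

/-- A right action of a group `G` on an `S`-scheme `X` by automorphisms of `X` over `S`:
`act g` is the automorphism `x ↦ x · g`. -/
structure RightAction (S : Scheme.{u}) (G : Type u) [Group G] (X : Scheme.{u}) [X.Over S] where
  act : G → (X ≅ X)
  act_one : act 1 = Iso.refl X
  act_mul : ∀ g h, act (g * h) = act g ≪≫ act h
  act_over : ∀ g, (act g).hom ≫ (X ↘ S) = X ↘ S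

namespace RightAction

variable {S : Scheme.{u}} {G H : Type u} [Group G] [Group H] {X : Scheme.{u}} [X.Over S]

/-- The action of `H` on `X` through a homomorphism `H →* G`. -/
def comp (a : RightAction S G X) (π : H →* G) : RightAction S H X where
  act h := a.act (π h)
  act_one := by rw [map_one, a.act_one]
  act_mul g h := by rw [map_mul, a.act_mul]
  act_over g := a.act_over _

/-- The action of `G` on `X` induced by an action of `H` along a surjection `H →* G` whose kernel
acts trivially: `g` acts as any of its lifts to `H`. -/
def descend (a : RightAction S H X) (π : H →* G) (hπ : Function.Surjective π)
    (ha : ∀ h ∈ π.ker, a.act h = Iso.refl X) : RightAction S G X :=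
  have key : ∀ h h', π h = π h' → a.act h = a.act h' := fun h h' e => by
    have h1 : h * h'⁻¹ ∈ π.ker := by rw [MonoidHom.mem_ker, map_mul, map_inv, e, mul_inv_cancel]
    calc a.act h = a.act (h * h'⁻¹ * h') := by rw [inv_mul_cancel_right]
      _ = a.act h' := by rw [a.act_mul, ha _ h1, Iso.refl_trans]
  { act := fun g => a.act (Function.surjInv hπ g)
    act_one := by
      rw [key _ 1 (by rw [Function.surjInv_eq hπ, map_one]), a.act_one]
    act_mul := fun g h => by
      rw [← a.act_mul]
      exact key _ _ (by rw [map_mul, Function.surjInv_eq hπ, Function.surjInv_eq hπ,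
        Function.surjInv_eq hπ])
    act_over := fun g => a.act_over _ }

end RightAction

/-- For a representation `V` of `G`, the right action of `G` on `ℙ(V^∨) = Proj (Sym V)`: the
right action on `V^∨` is `(ℓ · g)(v) = ℓ (g v)`, so pullback of functions along `g` is `Sym(g)`. -/
def ProjDual.action {k : Type u} [Field k] {G : Type u} [Group G] {V : Type u} [AddCommGroup V]
    [Module k V] (ρ : Representation k G V) : RightAction (Spec (.of k)) G (ProjDual k V) where
  act g := ProjDual.autOfInverse (ρ g) (ρ g⁻¹)
    (by rw [← Module.End.mul_eq_comp, ← map_mul, mul_inv_cancel, map_one]; rfl)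
    (by rw [← Module.End.mul_eq_comp, ← map_mul, inv_mul_cancel, map_one]; rfl)
  act_one := by
    ext1
    change Proj.map _ _ = 𝟙 _
    simp only [map_one]
    change Proj.map (SymProj.symMap LinearMap.id) _ = 𝟙 _
    simp only [SymProj.symMap_id]
    exact Proj.map_id
  act_mul g h := by
    ext1
    change Proj.map _ _ = Proj.map _ _ ≫ Proj.map _ _
    rw [← Proj.map_comp]
    simp only [map_mul, Module.End.mul_eq_comp, SymProj.symMap_comp]
  act_over g := ProjDual.map_over _ _

theorem ProjDual.action_eq_refl {k : Type u} [Field k] {G : Type u} [Group G] {V : Type u}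
    [AddCommGroup V] [Module k V] (ρ : Representation k G V) (g : G) (c : k)
    (h : ρ g = c • LinearMap.id) : (ProjDual.action ρ).act g = Iso.refl _ := by
  ext1
  change Proj.map _ _ = 𝟙 _
  simp only [h]
  exact ProjDual.map_smul_id c _

namespace AlgebraicGeometry.Scheme

variable {X Y Z : Scheme.{u}}

/-- The composition `f ∘ e` of an isomorphism `e` followed by a partial map `f`. -/
def PartialMap.isoComp (e : X ≅ Y) (f : Y.PartialMap Z) : X.PartialMap Z where
  domain := e.hom ⁻¹ᵁ f.domain
  dense_domain := f.dense_domain.preimage e.hom.isOpenEmbedding.isOpenMap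
  hom := (e.hom ∣_ f.domain) ≫ f.hom

/-- The composition `f ∘ e` of an isomorphism `e` followed by a rational map `f`. -/
def RationalMap.isoComp (e : X ≅ Y) (f : Y ⤏ Z) : X ⤏ Z :=
  Quotient.map (PartialMap.isoComp e) (by
    intro f₁ f₂ ⟨W, hW, hWl, hWr, h⟩
    refine ⟨e.hom ⁻¹ᵁ W, hW.preimage e.hom.isOpenEmbedding.isOpenMap,
      e.hom.preimage_mono hWl, e.hom.preimage_mono hWr, ?_⟩
    simp only [PartialMap.restrict_hom, PartialMap.isoComp] at h ⊢
    change X.homOfLE (e.hom.preimage_mono hWl) ≫ (e.hom ∣_ f₁.domain) ≫ f₁.hom =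
      X.homOfLE (e.hom.preimage_mono hWr) ≫ (e.hom ∣_ f₂.domain) ≫ f₂.hom
    rw [← morphismRestrict_homOfLE_assoc e.hom W _ hWl,
      ← morphismRestrict_homOfLE_assoc e.hom W _ hWr]
    exact congrArg (fun t => (e.hom ∣_ W) ≫ t) h) f

end AlgebraicGeometry.Scheme

/-- A rational map `f : Y ⤏ X` between schemes with right `G`-actions is `G`-equivariant if
`f (y · g) = f (y) · g` for all `g`, as an equality of rational maps. -/
def IsEquivariant {S : Scheme.{u}} {G : Type u} [Group G] {X Y : Scheme.{u}} [X.Over S] [Y.Over S]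
    (b : RightAction S G Y) (a : RightAction S G X) (f : Y ⤏ X) : Prop :=
  ∀ g : G, f.isoComp (b.act g) = f.compHom (a.act g).hom

/-- There is a dominant `G`-equivariant rational map `Y ⤏ X` over `S`. -/
def DominatesEquivariantly {S : Scheme.{u}} {G : Type u} [Group G] {X Y : Scheme.{u}} [X.Over S]
    [Y.Over S] (b : RightAction S G Y) (a : RightAction S G X) : Prop :=
  ∃ f : Y ⤏ X, f.IsOver S ∧ f.IsDominant ∧ IsEquivariant b a f

/-- `X` is a projective scheme over `k`: it embeds as a closed subscheme, over `k`, in some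
projective space `ℙⁿ` over `k`. -/
def IsProjectiveOver (k : Type u) [Field k] (X : Scheme.{u}) [X.Over (Spec (.of k))] : Prop :=
  ∃ (n : ℕ) (i : X ⟶ ProjDual k (Fin (n + 1) → k)),
    IsClosedImmersion i ∧ i ≫ (ProjDual k (Fin (n + 1) → k) ↘ Spec (.of k)) = X ↘ Spec (.of k)

/-! ### Unirationality and projective unirationality -/

/-- The `G`-action `a` on `X` is unirational: there are a finite-dimensional representation `V`
of `G` and a dominant `G`-equivariant rational map `ℙ(V^∨) ⤏ X` over `k`. -/
def IsUnirationalAction {k : Type u} [Field k] {G : Type u} [Group G] {X : Scheme.{u}}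
    [X.Over (Spec (.of k))] (a : RightAction (Spec (.of k)) G X) : Prop :=
  ∃ (V : Type u) (_ : AddCommGroup V) (_ : Module k V) (_ : FiniteDimensional k V)
    (ρ : Representation k G V), DominatesEquivariantly (ProjDual.action ρ) a

/-- A central cyclic extension `1 → Z → E → G → 1`: the group `Z` is finite cyclic and its image
in `E` is central. -/
structure CentralCyclicExtension (G : Type u) [Group G] where
  Z : Type u
  E : Type u
  [groupZ : Group Z]
  [groupE : Group E]
  [finiteZ : Finite Z]
  [cyclicZ : IsCyclic Z]
  ext : GroupExtension Z E G
  central : ext.inl.range ≤ Subgroup.center E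

attribute [instance] CentralCyclicExtension.groupZ CentralCyclicExtension.groupE
  CentralCyclicExtension.finiteZ CentralCyclicExtension.cyclicZ

/-- The `G`-action `a` on `X` is projectively unirational: for some central cyclic extension `E`
of `G`, the action of `E` on `X` through `E → G` is unirational. -/
def IsProjectivelyUnirational {k : Type u} [Field k] {G : Type u} [Group G] {X : Scheme.{u}}
    [X.Over (Spec (.of k))] (a : RightAction (Spec (.of k)) G X) : Prop :=
  ∃ C : CentralCyclicExtension G, IsUnirationalAction (a.comp C.ext.rightHom)

/-- `k^×` as a `G`-module with trivial action. (The coefficient ring `ℤ` is lifted to the universe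
of `k`, as the library's group cohomology asks for.) -/
abbrev unitsRep (k : Type u) [Field k] (G : Type u) [Group G] : Rep (ULift.{u} ℤ) G :=
  Rep.trivial (ULift.{u} ℤ) G (Additive kˣ)

/-- The cohomology group `H²(G, k^×)`, for the trivial action of `G` on `k^×`. -/
abbrev H2Units (k : Type u) [Field k] (G : Type u) [Group G] :=
  groupCohomology.H2 (unitsRep k G)

/-- The central cyclic extension `1 → Z → E → G → 1`, with an identification `χ` of `Z` with the
group of roots of unity of order dividing `|Z|` in `k`, has class `γ ∈ H²(G, k^×)`: for a
set-theoretic section `s` of `E → G`, the class `γ` is represented by the `2`-cocycle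
`(g, h) ↦ χ (s(g) s(h) s(gh)⁻¹)`. -/
def CentralCyclicExtension.HasClass {k : Type u} [Field k] {G : Type u} [Group G]
    (C : CentralCyclicExtension G) (χ : C.Z ≃* rootsOfUnity (Nat.card C.Z) k)
    (γ : H2Units k G) : Prop :=
  ∃ (s : C.ext.Section) (c : groupCohomology.cocycles₂ (unitsRep k G)),
    (∀ (g h : G) (z : C.Z), C.ext.inl z = s g * s h * (s (g * h))⁻¹ →
      c (g, h) = Additive.ofMul (χ z : kˣ)) ∧
    groupCohomology.H2π (unitsRep k G) c = γ

/-- The direct sum `W^m` of `m` copies of a representation `W`. -/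
def Representation.power {k : Type u} [Field k] {G : Type u} [Group G] {W : Type u}
    [AddCommGroup W] [Module k W] (ρ : Representation k G W) (m : ℕ) :
    Representation k G (Fin m → W) where
  toFun g := (ρ g).compLeft (Fin m)
  map_one' := by ext; simp
  map_mul' g h := by ext; simp

/-- The data fixed for a class `γ ∈ H²(G, k^×)`: a central cyclic extension
`1 → Z → Ĝ → G → 1` with an identification of `Z` with `⟨ζ⟩ ⊆ k^×`, `ζ` a primitive `|Z|`-th root
of unity, of class `γ`, and a finite-dimensional representation `W ≠ 0` of `Ĝ` such that the
subgroup of `Ĝ` acting on `W` by scalars is `Z`, acting via the identification with `⟨ζ⟩`. -/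
structure TestDatum (k : Type u) [Field k] (G : Type u) [Group G] (γ : H2Units k G) extends
    CentralCyclicExtension G where
  χ : Z ≃* rootsOfUnity (Nat.card Z) k
  hasClass : toCentralCyclicExtension.HasClass χ γ
  W : Type u
  [addCommGroupW : AddCommGroup W]
  [moduleW : Module k W]
  [finiteW : FiniteDimensional k W]
  [nontrivialW : Nontrivial W]
  ρ : Representation k E W
  scalar_iff : ∀ g : E, (∃ c : k, ρ g = c • LinearMap.id) ↔ g ∈ ext.inl.range
  scalar_eq : ∀ z : Z, ρ (ext.inl z) = ((χ z : kˣ) : k) • LinearMap.id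

attribute [instance] TestDatum.addCommGroupW TestDatum.moduleW TestDatum.finiteW
  TestDatum.nontrivialW

/-- The right action of `G` on `ℙ((W^m)^∨)`, induced by that of the extension `Ĝ`, in which
`Z = ker (Ĝ → G)` acts trivially. -/
def TestDatum.projAction {k : Type u} [Field k] {G : Type u} [Group G] {γ : H2Units k G}
    (T : TestDatum k G γ) (m : ℕ) :
    RightAction (Spec (.of k)) G (ProjDual k (Fin m → T.W)) :=
  (ProjDual.action (T.ρ.power m)).descend T.ext.rightHom T.ext.rightHom_surjective (by
    intro h hh
    rw [← T.ext.range_inl_eq_ker_rightHom] at hh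
    obtain ⟨z, rfl⟩ := hh
    refine ProjDual.action_eq_refl _ _ ((T.χ z : kˣ) : k) ?_
    refine LinearMap.ext fun w => funext fun i => ?_
    exact congrArg (fun F : T.W →ₗ[k] T.W => F (w i)) (T.scalar_eq z))

end

/-! The class group is finite because every class has a cocycle with values in the `|G|`-th roots of
unity. For the equivalence, (iii) gives (ii) by letting `Ĝ` act through `G`, and (ii) is a case of
(i). The content is (i) ⇒ (iii), which has a cohomological half and a field-theoretic half.

Let `E` be a central extension of `G` by a cyclic group `Z`, and `ℙ(V^∨) ⤏ X` dominant and
`E`-equivariant. Over an algebraically closed field of characteristic zero, `Z` has a faithful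
character `χ`. Pushing the class of `E` forward along `χ` gives `γ`. The projective representation
on `W_γ`, rescaled by a cochain, becomes a representation `W` of `E` on which `Z` acts by `χ` and is
exactly the group of scalars (`CentralCyclicExtension.exists_class_representation`).

It remains to replace `V` by `W^(d+2)`, where `d = dim V`
(`DominatesEquivariantly.of_scalar_representation`). Everything takes place in `Ω = k(W^(d+2) ⊕ V)`.
Let `L` be the field of ratios of linear forms on the first copy of `W`, `ω` a nonzero linear form
there, and `n = |Z|`. The group `E` acts faithfully on `k(W)`, and only `Z` acts trivially on `L`,
so Speiser's lemma (`mem_span_invariants`) provides invariant elements: `u_1, …, u_d` spanning the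
forms on `V` over `k(W)`, `h` spanning the line `L ω^n`, and `t` spanning over `L` the forms on the
other `d + 1` copies of `W` divided by `ω`. A count of transcendence degrees shows that `h`, `u`,
`t` are algebraically independent over `L`.

Put `K = L(h, u)`. Then `k(V)` lies in `K(ω)`, and averaging over `Z` keeps only the powers of `ω^n
∈ K`; hence `k(V)^Z ⊆ K`. As `Z` acts trivially on `X`, the field `k(X)` embeds in `k(V)^Z`.
Substituting `d + 1` of the `t` for `h, u` is an equivariant embedding of `K` over `L` whose image
consists of rational functions on `ℙ((W^(d+2))^∨)` (`exists_descending_embedding`). The resulting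
equivariant generic point of `X` spreads out to the required rational map
(`DominatesEquivariantly.of_densePoint`). -/

section InvariantSpanning

/-! ### Galois descent for subspaces of a field. -/

variable {k Ω E : Type*} [Field k] [Field Ω] [Algebra k Ω] [Group E]
  (σ : E →* (Ω ≃ₐ[k] Ω))

/-- The subgroup of the elements acting trivially on the intermediate field `L`. -/
def pointwiseFixer (L : IntermediateField k Ω) : Subgroup E where
  carrier := {e | ∀ x ∈ L, σ e x = x}
  one_mem' x _ := by simp
  mul_mem' {a b} ha hb x hx := by
    rw [map_mul, AlgEquiv.mul_apply, hb x hx, ha x hx]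
  inv_mem' {a} ha x hx := by
    rw [map_inv]
    exact (AlgEquiv.symm_apply_eq _).2 (ha x hx).symm

variable [Finite E]

/-- Speiser's lemma: a stable `L`-subspace, on which the elements fixing `L` act trivially,
is spanned by its invariant vectors. -/
theorem mem_span_invariants (L : IntermediateField k Ω) (hL : ∀ e, ∀ x ∈ L, σ e x ∈ L)
    (M : Submodule L Ω) (hM : ∀ e, ∀ x ∈ M, σ e x ∈ M)
    (htriv : ∀ e, (∀ x ∈ L, σ e x = x) → ∀ x ∈ M, σ e x = x) (y : Ω) (hy : y ∈ M) :
    y ∈ Submodule.span L {x | x ∈ M ∧ ∀ e, σ e x = x} := by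
  classical
  by_contra hcon
  -- An `L`-linear functional that kills all invariants of `M` but not `y`; Dedekind independence
  -- will contradict it.
  obtain ⟨f, hf, hf'⟩ := Submodule.exists_le_ker_of_notMem hcon
  let N := pointwiseFixer σ L
  let Q := E ⧸ N
  let _ : Fintype Q := Fintype.ofFinite Q
  -- On `M` the action depends only on the coset modulo `N`, so the representatives `q.out` may be
  -- chosen arbitrarily.
  have hN : ∀ a b : E, (QuotientGroup.mk a : Q) = QuotientGroup.mk b → ∀ x ∈ M, σ a x = σ b x := by
    intro a b hab x hx
    have h1 := htriv _ (QuotientGroup.eq.1 hab) x hx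
    rw [map_mul, AlgEquiv.mul_apply, map_inv] at h1
    exact ((AlgEquiv.symm_apply_eq _).1 h1).symm
  -- Traces of `b • y` over `E ⧸ N` are invariant: `e` permutes the cosets.
  have hinv : ∀ b : L, ∀ e, σ e (∑ q : Q, σ q.out (b • y)) = ∑ q : Q, σ q.out (b • y) := by
    intro b e
    rw [map_sum, ← Equiv.sum_comp (MulAction.toPerm e : Equiv.Perm Q)
      (fun q => σ q.out (b • y))]
    refine Finset.sum_congr rfl fun q _ => ?_
    rw [← AlgEquiv.mul_apply, ← map_mul]
    refine hN _ _ ?_ _ (M.smul_mem _ hy)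
    rw [QuotientGroup.out_eq', MulAction.toPerm_apply]
    conv_rhs => rw [← QuotientGroup.out_eq' q]
    rfl
  have hsum : ∀ b : L, ∑ q : Q, (f (σ q.out y) : Ω) * σ q.out (b : Ω) = 0 := by
    intro b
    have h1 : f (∑ q : Q, σ q.out (b • y)) = 0 :=
      hf' (Submodule.subset_span ⟨M.sum_mem fun q _ => hM _ _ (M.smul_mem _ hy), hinv b⟩)
    have h2 : ∀ q : Q, f (σ q.out (b • y)) = ⟨σ q.out (b : Ω), hL _ _ b.2⟩ * f (σ q.out y) := by
      intro q
      rw [← smul_eq_mul, ← map_smul]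
      congr 1
      simp [Algebra.smul_def]
    rw [map_sum] at h1
    simp only [h2] at h1
    have h3 := congrArg (algebraMap L Ω) h1
    rw [map_sum, map_zero] at h3
    rw [← h3]
    refine Finset.sum_congr rfl fun q _ => ?_
    rw [map_mul, mul_comm]
    rfl
  -- Distinct cosets restrict to distinct characters of `L`, so the relations `hsum` force every
  -- coefficient `f (σ q.out y)` to vanish; the trivial coset gives `f y = 0`.
  let F : Q → (L →* Ω) := fun q =>
    ((σ q.out : Ω →+* Ω) : Ω →* Ω).comp ((algebraMap L Ω : L →+* Ω) : L →* Ω)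
  have hF : Function.Injective F := by
    intro p q hpq
    rw [← QuotientGroup.out_eq' p, ← QuotientGroup.out_eq' q]
    refine QuotientGroup.eq.2 fun x hx => ?_
    have h1 : σ p.out x = σ q.out x := DFunLike.congr_fun hpq ⟨x, hx⟩
    rw [map_mul, AlgEquiv.mul_apply, ← h1, map_inv]
    exact AlgEquiv.symm_apply_apply _ _
  have hli := (linearIndependent_monoidHom L Ω).comp F hF
  rw [Fintype.linearIndependent_iff] at hli
  have h0 := hli (fun q => (f (σ q.out y) : Ω)) (by
    funext b
    simpa [F] using hsum b) (QuotientGroup.mk 1)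
  rw [hN _ 1 (QuotientGroup.out_eq' _) y hy, map_one, AlgEquiv.one_apply] at h0
  exact hf (Subtype.ext h0)

/-- By Speiser's lemma the span of `y` has a basis of invariant vectors, which has no more members
than `y`. Keeping the index type of `y` is what makes the later transcendence count possible. -/
theorem exists_invariant_spanning (L : IntermediateField k Ω) (hL : ∀ e, ∀ x ∈ L, σ e x ∈ L)
    {ι : Type*} [Finite ι] (y : ι → Ω)
    (hy : ∀ e i, σ e (y i) ∈ Submodule.span L (Set.range y))
    (htriv : ∀ e, (∀ x ∈ L, σ e x = x) → ∀ i, σ e (y i) = y i) :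
    ∃ t : ι → Ω, (∀ e i, σ e (t i) = t i) ∧ (∀ i, t i ∈ Submodule.span L (Set.range y)) ∧
      ∀ i, y i ∈ Submodule.span L (Set.range t) := by
  classical
  have := Fintype.ofFinite ι
  set M := Submodule.span L (Set.range y) with hMdef
  have hM : ∀ e, ∀ x ∈ M, σ e x ∈ M := by
    intro e x hx
    induction hx using Submodule.span_induction with
    | mem x hx => obtain ⟨i, rfl⟩ := hx; exact hy e i
    | zero => simp
    | add x z _ _ hx hz => rw [map_add]; exact M.add_mem hx hz
    | smul a x _ hx =>
      have : σ e (a • x) = (⟨σ e a, hL e _ a.2⟩ : L) • σ e x := by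
        simp [Algebra.smul_def]
      rw [this]; exact M.smul_mem _ hx
  have htriv' : ∀ e, (∀ x ∈ L, σ e x = x) → ∀ x ∈ M, σ e x = x := by
    intro e he x hx
    induction hx using Submodule.span_induction with
    | mem x hx => obtain ⟨i, rfl⟩ := hx; exact htriv e he i
    | zero => simp
    | add x z _ _ hx hz => rw [map_add, hx, hz]
    | smul a x _ hx =>
      have : σ e (a • x) = (⟨σ e a, hL e _ a.2⟩ : L) • σ e x := by
        simp [Algebra.smul_def]
      rw [this, hx]
      congr 1
      exact Subtype.ext (he _ a.2)
  obtain ⟨b, hbs, hbspan, hbli⟩ := exists_linearIndependent L {x | x ∈ M ∧ ∀ e, σ e x = x}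
  have hMb : M ≤ Submodule.span L b := by
    intro x hx
    rw [hbspan]
    exact mem_span_invariants σ L hL M hM htriv' x hx
  have hbM : Submodule.span L b ≤ Submodule.span L (Set.range y) :=
    Submodule.span_le.2 fun x hx => (hbs hx).1
  have hcard : Cardinal.mk b ≤ Cardinal.mk (Set.range y) := by
    rw [← rank_span_set hbli]
    exact (Submodule.rank_mono hbM).trans (rank_span_le _)
  obtain ⟨j⟩ : Nonempty (b ↪ Set.range y) := hcard
  have : Function.Surjective (Set.rangeFactorization y) := Set.rangeFactorization_surjective
  let g : b ↪ ι := j.trans ⟨Function.surjInv this, Function.injective_surjInv this⟩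
  -- The basis may be smaller than `ι`; the remaining entries are padded with `0`, which is
  -- invariant and lies in the span.
  let t : ι → Ω := Function.extend g Subtype.val 0
  have ht : ∀ i, t i = 0 ∨ t i ∈ b := by
    intro i
    by_cases hi : ∃ a, g a = i
    · obtain ⟨a, rfl⟩ := hi
      right
      simp only [t, g.injective.extend_apply]
      exact a.2
    · left
      simp only [t]
      rw [Function.extend_apply' _ _ _ hi]; rfl
  refine ⟨t, fun e i => ?_, fun i => ?_, fun i => ?_⟩
  · rcases ht i with h | h
    · rw [h, map_zero]
    · exact (hbs h).2 e
  · rcases ht i with h | h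
    · rw [h]; exact M.zero_mem
    · exact (hbs h).1
  · refine Submodule.span_mono ?_ (hMb (Submodule.subset_span ⟨i, rfl⟩))
    intro x hx
    exact ⟨g ⟨x, hx⟩, g.injective.extend_apply _ _ _⟩

end InvariantSpanning

/-! ### Algebraic independence, averaging over scalars, and equivariant substitution. -/

section

/-- A linear endomorphism that preserves the ratios of linear forms is a scalar. -/
theorem exists_eq_smul_id_of_ratio_eq {k Ω I W : Type*} [Field k] [Field Ω] [Algebra k Ω]
    [AddCommGroup W] [Module k W] (b : Module.Basis I k W) (l : W →ₗ[k] Ω)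
    (hl : AlgebraicIndependent k fun i => l (b i)) (T : W →ₗ[k] W) (w : W) (hw : w ≠ 0)
    (h : ∀ w', l (T w') * l w = l w' * l (T w)) : ∃ c : k, T = c • LinearMap.id := by
  -- By algebraic independence the identity between values of `l` lifts to an identity of
  -- polynomials, which can be evaluated at any point of the dual of `W`.
  let P : W →ₗ[k] MvPolynomial I k := b.constr k (fun i => MvPolynomial.X i)
  have hP : ∀ w, MvPolynomial.aeval (fun i => l (b i)) (P w) = l w := by
    intro w
    have : (MvPolynomial.aeval (fun i => l (b i))).toLinearMap ∘ₗ P = l := by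
      refine b.ext fun i => ?_
      simp [P, Module.Basis.constr_basis]
    exact LinearMap.congr_fun this w
  have hlinj : Function.Injective l :=
    LinearMap.injective_of_linearIndependent b.span_eq hl.linearIndependent
  have hP2 : ∀ w', P (T w') * P w = P w' * P (T w) := by
    intro w'
    apply hl
    simp only [map_mul, hP, h]
  have heval : ∀ (f : Module.Dual k W) w, MvPolynomial.eval (fun i => f (b i)) (P w) = f w := by
    intro f w
    have : (MvPolynomial.aeval (fun i => f (b i))).toLinearMap ∘ₗ P = f := by
      refine b.ext fun i => ?_
      simp [P, Module.Basis.constr_basis]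
    exact LinearMap.congr_fun this w
  have hTw : T w ∈ Submodule.span k {w} := by
    by_contra hcon
    obtain ⟨f, hf, hf'⟩ := Submodule.exists_le_ker_of_notMem hcon
    have hfw : f w = 0 := hf' (Submodule.mem_span_singleton_self w)
    -- With `w' = T w`, evaluation at a functional `f` killing `w` turns the identity into `0 = f (T
    -- w) ^ 2`.
    have h1 := congrArg (MvPolynomial.eval (fun i => f (b i))) (hP2 (T w))
    simp only [map_mul, heval, hfw, mul_zero] at h1
    exact hf (mul_self_eq_zero.1 h1.symm)
  obtain ⟨c, hc⟩ := Submodule.mem_span_singleton.1 hTw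
  refine ⟨c, LinearMap.ext fun w' => hlinj ?_⟩
  have hlw : l w ≠ 0 := fun h0 => hw (hlinj (by rw [h0, map_zero]))
  refine mul_right_cancel₀ hlw ?_
  rw [h w', ← hc]
  simp [Algebra.smul_def]
  ring

/-- Since `Ω` is algebraic over `k(y)`, the family `y` contains a transcendence basis; having at
most as many members as the transcendence degree, it must itself be one. -/
theorem AlgebraicIndependent.of_card_le {k Ω ι ι' : Type*} [Field k] [Field Ω] [Algebra k Ω]
    [Fintype ι] [Fintype ι'] {x : ι → Ω} (hx : AlgebraicIndependent k x) (y : ι' → Ω)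
    (hcard : Fintype.card ι' ≤ Fintype.card ι)
    (halg : Algebra.IsAlgebraic (IntermediateField.adjoin k (Set.range y)) Ω) :
    AlgebraicIndependent k y := by
  have := IntermediateField.isAlgebraic_adjoin_iff_top.1 halg
  refine (Algebra.IsAlgebraic.isTranscendenceBasis_of_lift_le_trdeg_of_finite k y ?_).1
  have h := hx.lift_cardinalMk_le_trdeg
  simp only [Cardinal.mk_fintype, Cardinal.lift_natCast, Cardinal.nat_le_lift_iff] at h ⊢
  exact le_trans (by exact_mod_cast hcard) h

section

variable {k Ω E : Type*} [Field k] [Field Ω] [Algebra k Ω] [Group E] (σ : E →* (Ω ≃ₐ[k] Ω))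

/-- Averaging over `Z` a polynomial expression in `ω` with coefficients in `K` multiplies the
coefficient of `ω ^ i` by the mean of `χ ^ i`. This vanishes unless `|Z|` divides `i`, in which case
`ω ^ i` is already in `K`. -/
theorem mem_of_fixed_of_mem_adjoin [CharZero k] (Z : Subgroup E) [Finite Z] (χ : Z →* kˣ)
    (hχ : Function.Injective χ) (K : IntermediateField k Ω) (ω : Ω)
    (hK : ∀ z : Z, ∀ x ∈ K, σ z x = x) (hω : ∀ z : Z, σ z ω = (χ z : k) • ω)
    (hωn : ω ^ Nat.card Z ∈ K) (x : Ω) (hx : x ∈ IntermediateField.adjoin K {ω})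
    (hxZ : ∀ z : Z, σ z x = x) : x ∈ K := by
  have := Fintype.ofFinite Z
  have hn : 0 < Nat.card Z := Nat.card_pos
  have hcyc : IsCyclic Z := isCyclic_of_injective_ringHom ((Units.coeHom k).comp χ)
    (Units.val_injective.comp hχ)
  have halg : IsAlgebraic K ω := by
    refine ⟨Polynomial.X ^ Nat.card Z - Polynomial.C ⟨_, hωn⟩,
      Polynomial.X_pow_sub_C_ne_zero hn _, ?_⟩
    simp
  rw [← IntermediateField.mem_toSubalgebra,
    IntermediateField.adjoin_simple_toSubalgebra_of_isAlgebraic halg,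
    Algebra.adjoin_singleton_eq_range_aeval] at hx
  obtain ⟨p, rfl⟩ := hx
  change ∀ z : Z, σ z (Polynomial.aeval ω p) = Polynomial.aeval ω p at hxZ
  change Polynomial.aeval ω p ∈ K
  have hpow : ∀ i : ℕ, (∑ z : Z, ((χ z : k) ^ i)) • ω ^ i ∈ K := by
    intro i
    by_cases hi : Nat.card Z ∣ i
    · obtain ⟨q, rfl⟩ := hi
      rw [pow_mul ω]
      exact K.smul_mem (pow_mem hωn q)
    · have h1 : ((Units.coeHom k).comp χ) ^ i ≠ 1 := by
        intro h
        apply hi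
        rw [← IsCyclic.exponent_eq_card, Monoid.exponent_dvd_iff_forall_pow_eq_one]
        intro z
        apply hχ
        rw [map_pow, map_one]
        exact Units.ext (by simpa using DFunLike.congr_fun h z)
      have h2 := sum_hom_units_eq_zero _ h1
      simp only [MonoidHom.pow_apply, MonoidHom.comp_apply, Units.coeHom_apply] at h2
      rw [h2, zero_smul]
      exact K.zero_mem
  have hsum : ∑ z : Z, σ z (Polynomial.aeval ω p) =
      p.sum fun i a => (a : Ω) * ((∑ z : Z, ((χ z : k) ^ i)) • ω ^ i) := by
    simp only [Polynomial.aeval_eq_sum_range, Polynomial.sum_over_range (f := fun i (a : K) =>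
      (a : Ω) * ((∑ z : Z, ((χ z : k) ^ i)) • ω ^ i)) (p := p) (by simp)]
    simp only [map_sum]
    rw [Finset.sum_comm]
    refine Finset.sum_congr rfl fun i _ => ?_
    rw [Finset.sum_smul, Finset.mul_sum]
    refine Finset.sum_congr rfl fun z _ => ?_
    rw [Algebra.smul_def, map_mul, map_pow, hω, smul_pow]
    congr 1
    exact hK z _ (p.coeff i).2
  have hmem : ∑ z : Z, σ z (Polynomial.aeval ω p) ∈ K := by
    rw [hsum, Polynomial.sum_def]
    exact sum_mem fun i _ => mul_mem (p.coeff i).2 (hpow i)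
  rw [Finset.sum_congr rfl fun z _ => hxZ z, Finset.sum_const, ← Nat.cast_smul_eq_nsmul k] at hmem
  have hc : ((Finset.univ : Finset Z).card : k) ≠ 0 := by
    rw [Finset.card_univ, ← Nat.card_eq_fintype_card]
    exact_mod_cast hn.ne'
  have := IntermediateField.smul_mem K (x := (((Finset.univ : Finset Z).card : k))⁻¹) hmem
  rwa [smul_smul, inv_mul_cancel₀ hc, one_smul] at this

/-- Both families are free generators over `L` fixed by the group, so replacing `a` by `b` is an
embedding over `L`. It commutes with the action because it does so on `L` and on each `a i`. -/
theorem exists_equivariant_substitution (L : IntermediateField k Ω)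
    (hL : ∀ e, ∀ x ∈ L, σ e x ∈ L) {ι : Type*} (a b : ι → Ω)
    (ha : AlgebraicIndependent L a) (hb : AlgebraicIndependent L b)
    (hσa : ∀ e i, σ e (a i) = a i) (hσb : ∀ e i, σ e (b i) = b i) :
    ∃ θ : IntermediateField.adjoin L (Set.range a) →ₐ[L] Ω,
      (∀ e (x : IntermediateField.adjoin L (Set.range a)),
        ∃ h : σ e x ∈ IntermediateField.adjoin L (Set.range a), θ ⟨σ e x, h⟩ = σ e (θ x)) ∧
      ∀ x, θ x ∈ IntermediateField.adjoin L (Set.range b) := by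
  let θ : IntermediateField.adjoin L (Set.range a) →ₐ[L] Ω :=
    (IntermediateField.val _).comp
      (hb.aevalEquivField.toAlgHom.comp ha.aevalEquivField.symm.toAlgHom)
  have hθ : ∀ i h, θ ⟨a i, h⟩ = b i := by
    intro i h
    have : ha.aevalEquivField.symm ⟨a i, h⟩ =
        algebraMap (MvPolynomial ι L) (FractionRing (MvPolynomial ι L)) (MvPolynomial.X i) := by
      rw [AlgEquiv.symm_apply_eq]
      apply Subtype.ext
      rw [AlgebraicIndependent.aevalEquivField_algebraMap_apply_coe, MvPolynomial.aeval_X]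
    change ((hb.aevalEquivField (ha.aevalEquivField.symm ⟨a i, h⟩) :
      IntermediateField.adjoin L (Set.range b)) : Ω) = b i
    rw [this, AlgebraicIndependent.aevalEquivField_algebraMap_apply_coe, MvPolynomial.aeval_X]
  refine ⟨θ, fun e ⟨x, hx⟩ => ?_, fun x => ?_⟩
  · induction hx using IntermediateField.adjoin_induction with
    | mem x hx =>
      obtain ⟨i, rfl⟩ := hx
      refine ⟨by rw [hσa]; exact IntermediateField.subset_adjoin _ _ ⟨i, rfl⟩, ?_⟩
      simp only [hσa, hθ, hσb]
    | algebraMap x =>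
      refine ⟨IntermediateField.algebraMap_mem _ (⟨σ e x, hL e _ x.2⟩ : L), ?_⟩
      have h1 := θ.commutes x
      have h2 := θ.commutes ⟨σ e x, hL e _ x.2⟩
      exact h2.trans (congrArg (σ e) h1.symm)
    | add x y hx hy ihx ihy =>
      obtain ⟨h1, e1⟩ := ihx
      obtain ⟨h2, e2⟩ := ihy
      refine ⟨by simpa using add_mem h1 h2, ?_⟩
      have : (⟨σ e (x + y), by simpa using add_mem h1 h2⟩ :
        IntermediateField.adjoin L (Set.range a)) = ⟨_, h1⟩ + ⟨_, h2⟩ := Subtype.ext (map_add _ _ _)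
      simp only [this]
      rw [map_add, e1, e2, ← map_add, ← map_add]
      rfl
    | inv x hx ihx =>
      obtain ⟨h1, e1⟩ := ihx
      refine ⟨by simpa using inv_mem h1, ?_⟩
      have : (⟨σ e x⁻¹, by simpa using inv_mem h1⟩ :
        IntermediateField.adjoin L (Set.range a)) = ⟨_, h1⟩⁻¹ := Subtype.ext (map_inv₀ _ _)
      simp only [this]
      rw [map_inv₀, e1, ← map_inv₀, ← map_inv₀]
      rfl
    | mul x y hx hy ihx ihy =>
      obtain ⟨h1, e1⟩ := ihx
      obtain ⟨h2, e2⟩ := ihy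
      refine ⟨by simpa using mul_mem h1 h2, ?_⟩
      have : (⟨σ e (x * y), by simpa using mul_mem h1 h2⟩ :
        IntermediateField.adjoin L (Set.range a)) = ⟨_, h1⟩ * ⟨_, h2⟩ := Subtype.ext (map_mul _ _ _)
      simp only [this]
      rw [map_mul, e1, e2, ← map_mul, ← map_mul]
      rfl
  · exact (hb.aevalEquivField (ha.aevalEquivField.symm x)).2

end

end

/-! ### Embedding the `Z`-invariants of `k(V)` in the function field of a projectivized power of
`W`. -/

section

theorem LinearMap.mem_of_basis_mem {k Ω W I : Type*} [Field k] [Field Ω] [Algebra k Ω]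
    [AddCommGroup W] [Module k W] (b : Module.Basis I k W) (l : W →ₗ[k] Ω) (M : Submodule k Ω)
    (h : ∀ i, l (b i) ∈ M) (w : W) : l w ∈ M := by
  have : (⊤ : Submodule k W) ≤ M.comap l := by
    rw [← b.span_eq, Submodule.span_le]
    rintro _ ⟨i, rfl⟩
    exact h i
  exact this trivial

theorem IntermediateField.mem_of_mem_span {k Ω : Type*} [Field k] [Field Ω] [Algebra k Ω]
    (L F : IntermediateField k Ω) (hLF : L ≤ F) (S : Set Ω) (hS : S ⊆ F) (x : Ω)
    (hx : x ∈ Submodule.span L S) : x ∈ F := by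
  induction hx using Submodule.span_induction with
  | mem x hx => exact hS hx
  | zero => exact F.zero_mem
  | add x y _ _ hx hy => exact F.add_mem hx hy
  | smul a x _ hx => exact F.mul_mem (hLF a.2) hx

theorem IntermediateField.mem_of_mem_adjoin {k Ω : Type*} [Field k] [Field Ω] [Algebra k Ω]
    (L F : IntermediateField k Ω) (hLF : L ≤ F) (S : Set Ω) (hS : S ⊆ F) (x : Ω)
    (hx : x ∈ IntermediateField.adjoin L S) : x ∈ F := by
  have : IntermediateField.adjoin L S ≤ IntermediateField.extendScalars hLF :=
    IntermediateField.adjoin_le_iff.2 hS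
  exact this hx

/-- The field `K` is `L(h, u)` and `θ` substitutes invariant ratios for `h, u`. The first of the `d
+ 2` copies of `W` carries `L`; each of the other `d + 1` supplies one target, for the `d` elements
`u` and the one element `h`. -/
theorem exists_descending_embedding {k Ω E W V I : Type*} [Field k] [CharZero k] [Field Ω]
    [Algebra k Ω] [Group E] [Finite E] (σ : E →* (Ω ≃ₐ[k] Ω))
    [AddCommGroup W] [Module k W] [AddCommGroup V] [Module k V] [Fintype I] [Nonempty I]
    (ρW : Representation k E W) (ρV : Representation k E V)
    (Z : Subgroup E) (χ : Z →* kˣ) (hχ : Function.Injective χ)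
    (hscal : ∀ e, (∃ c : k, ρW e = c • LinearMap.id) → e ∈ Z)
    (hρZ : ∀ z : Z, ρW z = (χ z : k) • LinearMap.id)
    {d : ℕ} (bW : Module.Basis I k W) (bV : Module.Basis (Fin d) k V)
    (lW : Fin (d + 2) → W →ₗ[k] Ω) (lV : V →ₗ[k] Ω)
    (hσW : ∀ e j w, σ e (lW j w) = lW j (ρW e w)) (hσV : ∀ e v, σ e (lV v) = lV (ρV e v))
    (hind : AlgebraicIndependent k (Sum.elim (fun p : Fin (d + 2) × I => lW p.1 (bW p.2))
      fun s => lV (bV s)))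
    (hgen : IntermediateField.adjoin k (Set.range (Sum.elim
      (fun p : Fin (d + 2) × I => lW p.1 (bW p.2)) fun s => lV (bV s))) = ⊤) :
    ∃ (K : IntermediateField k Ω) (θ : K →ₐ[k] Ω),
      (∀ x ∈ IntermediateField.adjoin k (Set.range lV), (∀ z ∈ Z, σ z x = x) → x ∈ K) ∧
      (∀ e (x : K), ∃ h : σ e x ∈ K, θ ⟨σ e x, h⟩ = σ e (θ x)) ∧
      ∀ x, θ x ∈ IntermediateField.adjoin k
        {y | ∃ j j' w w', lW j' w' ≠ 0 ∧ y = lW j w / lW j' w'} := by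
  classical
  obtain ⟨i₀⟩ := ‹Nonempty I›
  have hx0 : AlgebraicIndependent k fun i => lW 0 (bW i) :=
    hind.comp (fun i => Sum.inl (0, i)) fun i j h => by simpa using h
  have hinj : Function.Injective (lW 0) :=
    LinearMap.injective_of_linearIndependent bW.span_eq hx0.linearIndependent
  have hWnt : Nontrivial W := ⟨bW i₀, 0, bW.ne_zero i₀⟩
  set ω := lW 0 (bW i₀) with hωdef
  have hω : ω ≠ 0 := hx0.ne_zero i₀
  have hωe : ∀ e, lW 0 (ρW e (bW i₀)) ≠ 0 := fun e h0 => by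
    rw [← hσW] at h0
    exact hω ((map_eq_zero_iff _ (σ e).injective).1 h0)
  have hσω : ∀ e, σ e ω = lW 0 (ρW e (bW i₀)) := fun e => hσW e 0 _
  have hZω : ∀ z : Z, σ z ω = (χ z : k) • ω := fun z => by
    rw [hωdef, hσW, hρZ]; simp
  -- the field of ratios of linear forms on the first copy of `W`
  let xs : {i // i ≠ i₀} → Ω := fun i => lW 0 (bW i) / ω
  set L := IntermediateField.adjoin k (Set.range xs) with hLdef
  have hratio : ∀ w, lW 0 w / ω ∈ L := by
    intro w
    rw [div_eq_mul_inv, ← LinearMap.mulRight_apply (R := k), ← LinearMap.comp_apply]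
    refine LinearMap.mem_of_basis_mem bW _ L.toSubmodule (fun i => ?_) w
    simp only [LinearMap.comp_apply, LinearMap.mulRight_apply, ← div_eq_mul_inv]
    by_cases hi : i = i₀
    · rw [hi, ← hωdef, div_self hω]; exact L.one_mem
    · exact IntermediateField.subset_adjoin _ _ ⟨⟨i, hi⟩, rfl⟩
  have hL : ∀ e, ∀ x ∈ L, σ e x ∈ L := by
    intro e x hx
    have : L ≤ L.comap (σ e : Ω →ₐ[k] Ω) := by
      rw [hLdef, IntermediateField.adjoin_le_iff]
      rintro _ ⟨i, rfl⟩
      change σ e (lW 0 (bW i) / ω) ∈ L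
      rw [map_div₀, hσW, hσW, ← div_div_div_cancel_right₀ hω]
      exact div_mem (hratio _) (hratio _)
    exact this hx
  -- the function field of the first copy of `W`
  set L' := IntermediateField.adjoin k (Set.range (lW 0)) with hL'def
  have hL' : ∀ e, ∀ x ∈ L', σ e x ∈ L' := by
    intro e x hx
    have : L' ≤ L'.comap (σ e : Ω →ₐ[k] Ω) := by
      rw [hL'def, IntermediateField.adjoin_le_iff]
      rintro _ ⟨w, rfl⟩
      change σ e (lW 0 w) ∈ L'
      rw [hσW]
      exact IntermediateField.subset_adjoin _ _ ⟨_, rfl⟩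
    exact this hx
  have hfixL : ∀ e, (∀ x ∈ L, σ e x = x) → e ∈ Z := by
    intro e he
    refine hscal e (exists_eq_smul_id_of_ratio_eq bW (lW 0) hx0 (ρW e) (bW i₀) (bW.ne_zero i₀) ?_)
    intro w
    have h1 := he _ (hratio w)
    rw [map_div₀, hσW, hσW, div_eq_div_iff (hωe e) hω] at h1
    exact h1
  -- Fixing `k(W)` means acting trivially on `W`; such an element lies in `Z`, and `χ` is faithful.
  have hfixL' : ∀ e, (∀ x ∈ L', σ e x = x) → e = 1 := by
    intro e he
    have h1 : ρW e = LinearMap.id := LinearMap.ext fun w => hinj <| by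
      rw [← hσW, he _ (IntermediateField.subset_adjoin _ _ ⟨w, rfl⟩)]; rfl
    have hZ : e ∈ Z := hscal e ⟨1, by rw [h1, one_smul]⟩
    have h2 := hρZ ⟨e, hZ⟩
    rw [h1] at h2
    have h3 := LinearMap.congr_fun h2 (bW i₀)
    have h4 : (1 : k) • bW i₀ = (χ ⟨e, hZ⟩ : k) • bW i₀ := by simpa using h3
    have h5 := smul_left_injective k (bW.ne_zero i₀) h4
    have h6 : (⟨e, hZ⟩ : Z) = 1 := hχ (by rw [map_one]; exact Units.ext h5.symm)
    exact congrArg Subtype.val h6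
  have hZL : ∀ z : Z, ∀ x ∈ L, σ z x = x := by
    intro z x hx
    induction hx using IntermediateField.adjoin_induction with
    | mem x hx =>
      obtain ⟨i, rfl⟩ := hx
      simp only [xs, map_div₀, hZω, hσW, hρZ]
      rw [LinearMap.smul_apply, LinearMap.id_apply, map_smul, Algebra.smul_def, Algebra.smul_def,
        mul_div_mul_left]
      simp
    | algebraMap x => exact (σ z).commutes x
    | add x y _ _ hx hy => rw [map_add, hx, hy]
    | inv x _ hx => rw [map_inv₀, hx]
    | mul x y _ _ hx hy => rw [map_mul, hx, hy]
  -- Descent for the forms on `V` takes place over `L'`: elements of `Z` fix `L` but may move these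
  -- forms, so triviality of the fixer needs the larger field.
  obtain ⟨u, hu, -, hVu⟩ := exists_invariant_spanning σ L' hL' (fun s => lV (bV s))
    (fun e i => by
      rw [hσV]
      exact LinearMap.mem_of_basis_mem bV lV
        ((Submodule.span L' (Set.range fun s => lV (bV s))).restrictScalars k)
        (fun i => Submodule.subset_span ⟨i, rfl⟩) _)
    (fun e he i => by rw [hfixL' e he, map_one, AlgEquiv.one_apply])
  -- The power `ω ^ |Z|` is fixed by `Z`, since `χ` takes values of order dividing `|Z|`; hence its
  -- `L`-line descends, although that of `ω` need not.
  obtain ⟨h, hh, -, hωh⟩ := exists_invariant_spanning σ L hL (fun _ : Unit => ω ^ Nat.card Z)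
    (fun e i => by
      have : σ e (ω ^ Nat.card Z) =
          (⟨_, pow_mem (hratio (ρW e (bW i₀))) (Nat.card Z)⟩ : L) • ω ^ Nat.card Z := by
        rw [map_pow, hσω, Algebra.smul_def]
        change _ = (lW 0 (ρW e (bW i₀)) / ω) ^ _ * _
        rw [← mul_pow, div_mul_cancel₀ _ hω]
      rw [this]
      exact Submodule.smul_mem _ _ (Submodule.subset_span ⟨i, rfl⟩))
    (fun e he i => by
      have hz := hZω ⟨e, hfixL e he⟩
      change σ e ω = _ at hz
      rw [map_pow, hz, smul_pow, ← Units.val_pow_eq_pow_val, ← map_pow, pow_card_eq_one', map_one,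
        Units.val_one, one_smul])
  -- Dividing by `ω` cancels `χ`, so `Z` fixes these ratios and descent over `L` applies to each
  -- remaining copy.
  have ht' : ∀ j : Fin (d + 1), ∃ t : I → Ω, (∀ e i, σ e (t i) = t i) ∧
      (∀ i, t i ∈ Submodule.span L (Set.range fun i => lW j.succ (bW i) / ω)) ∧
      ∀ i, lW j.succ (bW i) / ω ∈ Submodule.span L (Set.range t) := fun j =>
    exists_invariant_spanning σ L hL _ (fun e i => by
      have h1 : σ e (lW j.succ (bW i) / ω) =
          (⟨_, inv_mem (hratio (ρW e (bW i₀)))⟩ : L) • (lW j.succ (ρW e (bW i)) / ω) := by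
        rw [map_div₀, hσω, hσW, Algebra.smul_def]
        change _ = (lW 0 (ρW e (bW i₀)) / ω)⁻¹ * _
        have := hωe e
        field_simp
      rw [h1]
      refine Submodule.smul_mem _ _ ?_
      rw [div_eq_mul_inv, ← LinearMap.mulRight_apply (R := k), ← LinearMap.comp_apply]
      refine LinearMap.mem_of_basis_mem bW _ ((Submodule.span L _).restrictScalars k)
        (fun i => ?_) _
      simp only [LinearMap.comp_apply, LinearMap.mulRight_apply, ← div_eq_mul_inv]
      exact Submodule.subset_span ⟨i, rfl⟩)
    (fun e he i => by
      have hz := hZω ⟨e, hfixL e he⟩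
      have hz' := hρZ ⟨e, hfixL e he⟩
      change σ e ω = _ at hz
      change ρW e = _ at hz'
      rw [map_div₀, hz, hσW, hz', LinearMap.smul_apply, LinearMap.id_apply, map_smul,
        Algebra.smul_def, Algebra.smul_def, mul_div_mul_left]
      simp)
  choose t ht htmem hWt using ht'
  let hu' : Option (Fin d) → Ω := fun o => o.elim (h ()) u
  let tt : Fin (d + 1) × I → Ω := fun p => t p.1 p.2
  let Y := Sum.elim (Sum.elim hu' tt) xs
  -- From `h` one recovers `ω` algebraically, then the first copy of `W` from the ratios, and
  -- finally the other copies and `V` by linear combinations.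
  have halg : Algebra.IsAlgebraic (IntermediateField.adjoin k (Set.range Y)) Ω := by
    set K := IntermediateField.adjoin k (Set.range Y) with hKdef
    have hYK : ∀ y, Y y ∈ K := fun y => IntermediateField.subset_adjoin _ _ ⟨y, rfl⟩
    have hLK : L ≤ K := by
      rw [hLdef, IntermediateField.adjoin_le_iff]
      rintro _ ⟨i, rfl⟩
      exact hYK (Sum.inr i)
    let A : IntermediateField k Ω := (algebraicClosure K Ω).restrictScalars k
    have hKA : K ≤ A := fun x hx => (algebraicClosure K Ω).algebraMap_mem ⟨x, hx⟩
    have hωA : ω ∈ A := by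
      have hωn : ω ^ Nat.card Z ∈ K := IntermediateField.mem_of_mem_span L K hLK (Set.range h)
        (by rintro _ ⟨i, rfl⟩; exact hYK (Sum.inl (Sum.inl none))) _ (hωh ())
      refine mem_algebraicClosure_iff.2 (IsAlgebraic.of_pow (n := Nat.card Z) Nat.card_pos ?_)
      exact isAlgebraic_algebraMap (⟨_, hωn⟩ : K)
    have hWA : ∀ w, lW 0 w ∈ A := fun w => by
      rw [← div_mul_cancel₀ (lW 0 w) hω]
      exact mul_mem (hKA (hLK (hratio w))) hωA
    have hL'A : L' ≤ A := by
      rw [hL'def, IntermediateField.adjoin_le_iff]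
      rintro _ ⟨w, rfl⟩
      exact hWA w
    have hA : A = ⊤ := by
      rw [← top_le_iff, ← hgen, IntermediateField.adjoin_le_iff]
      rintro _ ⟨⟨j, i⟩ | s, rfl⟩
      · simp only [Sum.elim_inl]
        induction j using Fin.cases with
        | zero => exact hWA _
        | succ j =>
          rw [← div_mul_cancel₀ (lW j.succ (bW i)) hω]
          refine mul_mem (hKA ?_) hωA
          refine IntermediateField.mem_of_mem_span L K hLK _ ?_ _ (hWt j i)
          rintro _ ⟨i, rfl⟩
          exact hYK (Sum.inl (Sum.inr (j, i)))
      · simp only [Sum.elim_inr]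
        refine IntermediateField.mem_of_mem_span L' A hL'A _ ?_ _ (hVu s)
        rintro _ ⟨i, rfl⟩
        exact hKA (hYK (Sum.inl (Sum.inl (some i))))
    exact ⟨fun x => mem_algebraicClosure_iff.1 (show x ∈ A from hA ▸ IntermediateField.mem_top)⟩
  -- With `r = dim W`, the count is `(d + 1) + (d + 1) r + (r - 1) = (d + 2) r + d`: the extra
  -- generator `h` makes up for the ratio lost at `i₀`.
  have hcard : Fintype.card ((Option (Fin d) ⊕ (Fin (d + 1) × I)) ⊕ {i // i ≠ i₀}) ≤
      Fintype.card ((Fin (d + 2) × I) ⊕ Fin d) := by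
    have hI : 0 < Fintype.card I := Fintype.card_pos_iff.2 ⟨i₀⟩
    simp only [Fintype.card_sum, Fintype.card_option, Fintype.card_fin, Fintype.card_prod,
      Fintype.card_subtype_compl, Fintype.card_unique, ne_eq]
    have : (d + 2) * Fintype.card I = (d + 1) * Fintype.card I + Fintype.card I := by ring
    omega
  have hLind : AlgebraicIndependent L (Sum.elim hu' tt) :=
    IntermediateField.algebraicIndependent_adjoin_iff.2
      (AlgebraicIndependent.sumElim_iff.1 (hind.of_card_le Y hcard halg)).2
  -- The targets are the invariants `t j i₀`, one for each of the `d + 1` remaining copies; `Option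
  -- (Fin d)` indexes `h` and `u`.
  let b : Option (Fin d) → Ω := fun o => tt ((finSuccEquiv d).symm o, i₀)
  have hσhu : ∀ e i, σ e (hu' i) = hu' i := by
    rintro e (_ | i)
    · exact hh e ()
    · exact hu e i
  obtain ⟨θ, hθσ, hθb⟩ := exists_equivariant_substitution σ L hL hu' b
    (hLind.comp Sum.inl Sum.inl_injective)
    (hLind.comp (fun o => Sum.inr ((finSuccEquiv d).symm o, i₀)) fun o o' ho => by simpa using ho)
    hσhu (fun e i => ht _ e _)
  let K : IntermediateField k Ω :=
    (IntermediateField.adjoin L (Set.range hu')).restrictScalars k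
  have hLK : L ≤ K := fun x hx =>
    (IntermediateField.adjoin L (Set.range hu')).algebraMap_mem ⟨x, hx⟩
  have huK : ∀ o, hu' o ∈ K := fun o => IntermediateField.subset_adjoin L _ ⟨o, rfl⟩
  refine ⟨K, θ.restrictScalars k, fun x hx hxZ => ?_, hθσ, fun x => ?_⟩
  · refine mem_of_fixed_of_mem_adjoin σ Z χ hχ K ω (fun z x hx => ?_) hZω ?_ x ?_
      fun z => hxZ z z.2
    · change x ∈ IntermediateField.adjoin L (Set.range hu') at hx
      induction hx using IntermediateField.adjoin_induction with
      | mem x hx => obtain ⟨i, rfl⟩ := hx; exact hσhu _ _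
      | algebraMap x => exact hZL z _ x.2
      | add x y _ _ hx hy => rw [map_add, hx, hy]
      | inv x _ hx => rw [map_inv₀, hx]
      | mul x y _ _ hx hy => rw [map_mul, hx, hy]
    · exact IntermediateField.mem_of_mem_span L K hLK (Set.range h)
        (by rintro _ ⟨i, rfl⟩; exact huK none) _ (hωh ())
    -- Adjoining `ω` to `K` recovers `k(W)` from `L`, hence all of `k(V)` from `u`.
    · let F : IntermediateField k Ω := (IntermediateField.adjoin K {ω}).restrictScalars k
      have hKF : K ≤ F := fun x hx => (IntermediateField.adjoin K {ω}).algebraMap_mem ⟨x, hx⟩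
      have hωF : ω ∈ F := IntermediateField.mem_adjoin_simple_self K ω
      have hL'F : L' ≤ F := by
        rw [hL'def, IntermediateField.adjoin_le_iff]
        rintro _ ⟨w, rfl⟩
        rw [← div_mul_cancel₀ (lW 0 w) hω]
        exact mul_mem (hKF (hLK (hratio w))) hωF
      have hVF : IntermediateField.adjoin k (Set.range lV) ≤ F := by
        rw [IntermediateField.adjoin_le_iff]
        rintro _ ⟨v, rfl⟩
        refine LinearMap.mem_of_basis_mem bV lV F.toSubmodule (fun s => ?_) v
        refine IntermediateField.mem_of_mem_span L' F hL'F _ ?_ _ (hVu s)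
        rintro _ ⟨i, rfl⟩
        exact hKF (huK (some i))
      exact hVF hx
  · set M := IntermediateField.adjoin k {y | ∃ j j' w w', lW j' w' ≠ 0 ∧ y = lW j w / lW j' w'}
    have hM : ∀ j w, lW j w / ω ∈ M := fun j w =>
      IntermediateField.subset_adjoin _ _ ⟨j, 0, w, bW i₀, hω, rfl⟩
    have hLM : L ≤ M := by
      rw [hLdef, IntermediateField.adjoin_le_iff]
      rintro _ ⟨i, rfl⟩
      exact hM _ _
    refine IntermediateField.mem_of_mem_adjoin L M hLM _ ?_ _ (hθb x)
    rintro _ ⟨o, rfl⟩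
    refine IntermediateField.mem_of_mem_span L M hLM _ ?_ _ (htmem _ _)
    rintro _ ⟨i, rfl⟩
    exact hM _ _

end

/-! ### Rational maps and dense field-valued points. -/

noncomputable section

namespace AlgebraicGeometry

/-- A field extension is faithfully flat. Equalities of morphisms out of the spectrum of a field can
thus be checked over a larger field. -/
instance epi_specMap_of_field {K L : Type u} [Field K] [Field L] (φ : K →+* L) :
    Epi (Spec.map (CommRingCat.ofHom φ)) := by
  algebraize [φ]
  have : Flat (Spec.map (CommRingCat.ofHom φ)) := by
    rw [Flat.SpecMap_iff]
    exact inferInstanceAs (Module.Flat K L)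
  have : Surjective (Spec.map (CommRingCat.ofHom φ)) :=
    ⟨fun x => ⟨IsLocalRing.closedPoint L, Subsingleton.elim _ _⟩⟩
  exact Flat.epi_of_flat_of_surjective _

/-- A field-valued point of a scheme is dense if it lies in every nonempty open subset. -/
def IsDensePoint {Ω : Type u} [Field Ω] {Y : Scheme.{u}} (η : Spec (.of Ω) ⟶ Y) : Prop :=
  ∀ (p : Spec (.of Ω)) (U : Y.Opens), (U : Set Y).Nonempty → η p ∈ U

variable {Ω : Type u} [Field Ω] {X Y : Scheme.{u}}

theorem IsDensePoint.specMap {Ω' : Type u} [Field Ω'] {η : Spec (.of Ω) ⟶ Y}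
    (hη : IsDensePoint η) (φ : Ω →+* Ω') :
    IsDensePoint (Spec.map (CommRingCat.ofHom φ) ≫ η) := fun p U hU => by
  rw [Scheme.Hom.comp_apply]
  exact hη _ U hU

theorem IsDensePoint.comp_iso {η : Spec (.of Ω) ⟶ Y} (hη : IsDensePoint η) (e : Y ≅ X) :
    IsDensePoint (η ≫ e.hom) := fun p U hU => by
  rw [Scheme.Hom.comp_apply]
  refine hη p (e.hom ⁻¹ᵁ U) ?_
  obtain ⟨x, hx⟩ := hU
  obtain ⟨y, rfl⟩ := e.hom.homeomorph.surjective x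
  exact ⟨y, hx⟩

theorem IsDensePoint.apply_eq_genericPoint [IsIntegral Y] {η : Spec (.of Ω) ⟶ Y}
    (hη : IsDensePoint η) (p : Spec (.of Ω)) : η p = genericPoint Y := by
  have : IsGenericPoint (η p) Set.univ := by
    rw [isGenericPoint_def]
    refine Dense.closure_eq ?_
    rw [dense_iff_inter_open]
    intro U hU hne
    exact ⟨η p, hη p ⟨U, hU⟩ hne, rfl⟩
  exact this.eq (genericPoint_spec Y)

theorem IsDensePoint.exists_functionField_hom [IsIntegral Y] {η : Spec (.of Ω) ⟶ Y}
    (hη : IsDensePoint η) : ∃ j : Y.functionField →+* Ω,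
      Spec.map (CommRingCat.ofHom j) ≫ Y.fromSpecStalk (genericPoint Y) = η := by
  have h1 := hη.apply_eq_genericPoint (IsLocalRing.closedPoint Ω)
  have h2 := Scheme.Spec_stalkClosedPointTo_fromSpecStalk η
  have : ∀ x, η (IsLocalRing.closedPoint Ω) = x → ∃ j : Y.presheaf.stalk x ⟶ .of Ω,
      Spec.map j ≫ Y.fromSpecStalk x = η := by
    rintro _ rfl
    exact ⟨_, h2⟩
  obtain ⟨j, hj⟩ := this _ h1
  exact ⟨j.hom, hj⟩

theorem isDensePoint_specMap_fromSpecStalk [IsIntegral Y] (j : Y.functionField →+* Ω) :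
    IsDensePoint (Spec.map (CommRingCat.ofHom j) ≫ Y.fromSpecStalk (genericPoint Y)) := by
  intro p U hU
  rw [Scheme.Hom.comp_apply]
  have : Spec.map (CommRingCat.ofHom j) p = IsLocalRing.closedPoint Y.functionField :=
    Subsingleton.elim (α := PrimeSpectrum Y.functionField) _ _
  rw [this]
  have h2 := Scheme.fromSpecStalk_closedPoint (X := Y) (x := genericPoint Y)
  have h3 : genericPoint Y ∈ U :=
    (genericPoint_spec Y).mem_open_set_iff U.2 |>.2 (by simpa using hU)
  exact Set.mem_of_eq_of_mem h2 h3

theorem IsDensePoint.range_subset {η : Spec (.of Ω) ⟶ Y} (hη : IsDensePoint η) {U : Y.Opens}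
    (hU : Dense (U : Set Y)) : Set.range η ⊆ Set.range U.ι := by
  have : Nonempty Y := ⟨η (IsLocalRing.closedPoint Ω)⟩
  rintro _ ⟨p, rfl⟩
  rw [Scheme.Opens.range_ι]
  exact hη p U hU.nonempty

namespace Scheme.PartialMap

/-- The value of a partial map at a dense field-valued point. -/
def evalPoint (f : Y.PartialMap X) {η : Spec (.of Ω) ⟶ Y} (hη : IsDensePoint η) :
    Spec (.of Ω) ⟶ X :=
  IsOpenImmersion.lift f.domain.ι η (hη.range_subset f.dense_domain) ≫ f.hom

theorem evalPoint_eq (f : Y.PartialMap X) {η : Spec (.of Ω) ⟶ Y} (hη : IsDensePoint η)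
    (l : Spec (.of Ω) ⟶ f.domain) (hl : l ≫ f.domain.ι = η) : f.evalPoint hη = l ≫ f.hom := by
  rw [evalPoint]
  congr 1
  rw [← cancel_mono f.domain.ι, IsOpenImmersion.lift_fac, hl]

theorem evalPoint_congr {f g : Y.PartialMap X} (h : f.equiv g) {η : Spec (.of Ω) ⟶ Y}
    (hη : IsDensePoint η) : f.evalPoint hη = g.evalPoint hη := by
  obtain ⟨U, hU, hUf, hUg, e⟩ := h
  let l := IsOpenImmersion.lift U.ι η (hη.range_subset hU)
  rw [f.evalPoint_eq hη (l ≫ Y.homOfLE hUf) (by simp [l]),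
    g.evalPoint_eq hη (l ≫ Y.homOfLE hUg) (by simp [l]), Category.assoc, Category.assoc]
  exact congrArg (l ≫ ·) e

theorem evalPoint_compHom {Z : Scheme.{u}} (f : Y.PartialMap X) (a : X ⟶ Z)
    {η : Spec (.of Ω) ⟶ Y} (hη : IsDensePoint η) :
    (f.compHom a).evalPoint hη = f.evalPoint hη ≫ a :=
  (Category.assoc _ _ _).symm

theorem evalPoint_isoComp {Y' : Scheme.{u}} (e : Y ≅ Y') (f : Y'.PartialMap X)
    {η : Spec (.of Ω) ⟶ Y} (hη : IsDensePoint η) :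
    (f.isoComp e).evalPoint hη = f.evalPoint (hη.comp_iso e) := by
  let l : Spec (.of Ω) ⟶ (e.hom ⁻¹ᵁ f.domain).toScheme :=
    IsOpenImmersion.lift (e.hom ⁻¹ᵁ f.domain).ι η (hη.range_subset (f.isoComp e).dense_domain)
  have hl : l ≫ (e.hom ⁻¹ᵁ f.domain).ι = η := IsOpenImmersion.lift_fac _ _ _
  refine ((f.isoComp e).evalPoint_eq hη l hl).trans ?_
  rw [f.evalPoint_eq (hη.comp_iso e) (l ≫ (e.hom ∣_ f.domain))
    (by rw [Category.assoc, morphismRestrict_ι, reassoc_of% hl]), Category.assoc]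
  rfl

theorem evalPoint_specMap {Ω' : Type u} [Field Ω'] (f : Y.PartialMap X) {η : Spec (.of Ω) ⟶ Y}
    (hη : IsDensePoint η) (φ : Ω →+* Ω') :
    f.evalPoint (hη.specMap φ) = Spec.map (CommRingCat.ofHom φ) ≫ f.evalPoint hη := by
  rw [f.evalPoint_eq (hη.specMap φ) (Spec.map (CommRingCat.ofHom φ) ≫
    IsOpenImmersion.lift f.domain.ι η (hη.range_subset f.dense_domain)) (by simp),
    Category.assoc]
  rfl

theorem evalPoint_functionField [IsIntegral Y] (f : Y.PartialMap X) (j : Y.functionField →+* Ω) :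
    f.evalPoint (isDensePoint_specMap_fromSpecStalk j) =
      Spec.map (CommRingCat.ofHom j) ≫ f.fromFunctionField := by
  rw [f.evalPoint_eq _ (Spec.map (CommRingCat.ofHom j) ≫ f.domain.fromSpecStalkOfMem _
    ((genericPoint_specializes _).mem_open f.domain.2 f.dense_domain.nonempty.choose_spec))
    (by rw [Category.assoc, Scheme.Opens.fromSpecStalkOfMem_ι]), Category.assoc]
  rfl

theorem evalPoint_over {S : Scheme.{u}} [X.Over S] [Y.Over S] (f : Y.PartialMap X) [f.IsOver S]
    {η : Spec (.of Ω) ⟶ Y} (hη : IsDensePoint η) :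
    f.evalPoint hη ≫ (X ↘ S) = η ≫ (Y ↘ S) := by
  have h : f.hom ≫ (X ↘ S) = f.domain.ι ≫ (Y ↘ S) := by
    simp
  rw [evalPoint, Category.assoc, h, IsOpenImmersion.lift_fac_assoc]

theorem isDensePoint_evalPoint (f : Y.PartialMap X) [IsDominant f.hom]
    {η : Spec (.of Ω) ⟶ Y} (hη : IsDensePoint η) : IsDensePoint (f.evalPoint hη) := by
  intro p U hU
  obtain ⟨_, hy, ⟨y, rfl⟩⟩ :=
    (IsDominant.denseRange (f := f.hom)).inter_open_nonempty U U.2 hU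
  have h1 := hη p (f.domain.ι ''ᵁ (f.hom ⁻¹ᵁ U)) ⟨f.domain.ι y, ⟨y, hy, rfl⟩⟩
  obtain ⟨y', hy', e⟩ := h1
  rw [evalPoint, Scheme.Hom.comp_apply]
  have h2 : f.domain.ι (IsOpenImmersion.lift f.domain.ι η
      (hη.range_subset f.dense_domain) p) = η p := by
    rw [← Scheme.Hom.comp_apply, IsOpenImmersion.lift_fac]
  have h3 := f.domain.ι.isOpenEmbedding.injective (e.trans h2.symm)
  rw [← h3]
  exact hy'

end Scheme.PartialMap

end AlgebraicGeometry

/-- A field endomorphism that lifts the action of `g` at a dense point of `Y` also lifts it at the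
image point, since rational maps agreeing on a dense open have the same value at a dense point. -/
theorem IsEquivariant.evalPoint_eq {S : Scheme.{u}} {G : Type u} [Group G] {X Y : Scheme.{u}}
    [X.Over S] [Y.Over S] {b : RightAction S G Y} {a : RightAction S G X} {f : Y.PartialMap X}
    (hf : IsEquivariant b a f.toRationalMap) {Ω : Type u} [Field Ω] {η : Spec (.of Ω) ⟶ Y}
    (hη : IsDensePoint η) (g : G) (σ : Ω →+* Ω)
    (hσ : Spec.map (CommRingCat.ofHom σ) ≫ η = η ≫ (b.act g).hom) :
    Spec.map (CommRingCat.ofHom σ) ≫ f.evalPoint hη = f.evalPoint hη ≫ (a.act g).hom := by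
  have h1 : (f.isoComp (b.act g)).equiv (f.compHom (a.act g).hom) :=
    Scheme.PartialMap.toRationalMap_eq_iff.1 (hf g)
  have h2 := Scheme.PartialMap.evalPoint_congr h1 hη
  rw [Scheme.PartialMap.evalPoint_isoComp, Scheme.PartialMap.evalPoint_compHom] at h2
  rw [← h2, ← f.evalPoint_specMap hη]
  congr 1

/-- A dense field-valued point of `X` with values in the function field of `Y`, equivariant for
lifts of the actions to a field extension, spreads out to an equivariant rational map. -/
theorem DominatesEquivariantly.of_densePoint {S : Scheme.{u}} {G : Type u} [Group G]
    {X Y : Scheme.{u}} [X.Over S] [Y.Over S] [IsIntegral X] [IsIntegral Y]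
    [LocallyOfFiniteType (X ↘ S)] (b : RightAction S G Y) (a : RightAction S G X)
    {Ω : Type u} [Field Ω] (i : Y.functionField →+* Ω) (j : X.functionField →+* Ω)
    (hij : j.range ≤ i.range)
    (hS : Spec.map (CommRingCat.ofHom i) ≫ Y.fromSpecStalk (genericPoint Y) ≫ (Y ↘ S) =
      Spec.map (CommRingCat.ofHom j) ≫ X.fromSpecStalk (genericPoint X) ≫ (X ↘ S))
    (hG : ∀ g, ∃ σ : Ω →+* Ω,
      Spec.map (CommRingCat.ofHom σ) ≫ Spec.map (CommRingCat.ofHom i) ≫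
          Y.fromSpecStalk (genericPoint Y) =
        Spec.map (CommRingCat.ofHom i) ≫ Y.fromSpecStalk (genericPoint Y) ≫ (b.act g).hom ∧
      Spec.map (CommRingCat.ofHom σ) ≫ Spec.map (CommRingCat.ofHom j) ≫
          X.fromSpecStalk (genericPoint X) =
        Spec.map (CommRingCat.ofHom j) ≫ X.fromSpecStalk (genericPoint X) ≫ (a.act g).hom) :
    DominatesEquivariantly b a := by
  -- The point of `X` is defined over the function field of `Y`; finite type over the base then lets
  -- it spread out to a partial map.
  obtain ⟨c, hc⟩ : ∃ c : X.functionField →+* Y.functionField, i.comp c = j := by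
    let ei := RingEquiv.ofBijective i.rangeRestrict
      ⟨fun x y h => i.injective (congrArg Subtype.val h), i.rangeRestrict_surjective⟩
    refine ⟨(ei.symm : i.range →+* Y.functionField).comp
      ((Subring.inclusion hij).comp j.rangeRestrict), RingHom.ext fun x => ?_⟩
    exact congrArg Subtype.val (ei.apply_symm_apply (Subring.inclusion hij (j.rangeRestrict x)))
  have hj : Spec.map (CommRingCat.ofHom j) =
      Spec.map (CommRingCat.ofHom i) ≫ Spec.map (CommRingCat.ofHom c) := by
    rw [← hc, CommRingCat.ofHom_comp, Spec.map_comp]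
  let τ : Spec Y.functionField ⟶ X :=
    Spec.map (CommRingCat.ofHom c) ≫ X.fromSpecStalk (genericPoint X)
  have hτ : Spec.map (CommRingCat.ofHom i) ≫ τ =
      Spec.map (CommRingCat.ofHom j) ≫ X.fromSpecStalk (genericPoint X) := by
    rw [hj, Category.assoc]; rfl
  have hτS : τ ≫ (X ↘ S) = Y.fromSpecStalk (genericPoint Y) ≫ (Y ↘ S) := by
    rw [← cancel_epi (Spec.map (CommRingCat.ofHom i)), hS, reassoc_of% hτ]
  let f := Scheme.PartialMap.ofFromSpecStalk (Y ↘ S) (X ↘ S) τ hτS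
  have hf : f.fromFunctionField = τ :=
    Scheme.PartialMap.fromSpecStalkOfMem_ofFromSpecStalk (Y ↘ S) (X ↘ S) τ hτS
  have hfS : f.IsOver S :=
    ⟨Scheme.PartialMap.ofFromSpecStalk_comp (Y ↘ S) (X ↘ S) τ hτS⟩
  have hτd : IsDensePoint (Ω := Y.functionField) τ := isDensePoint_specMap_fromSpecStalk c
  have hdom : IsDominant f.hom := by
    refine ⟨dense_iff_inter_open.2 fun U hU hne => ?_⟩
    have h1 := hτd (IsLocalRing.closedPoint Y.functionField) ⟨U, hU⟩ hne
    rw [← hf] at h1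
    exact ⟨_, h1, ⟨f.domain.fromSpecStalkOfMem _ _ (IsLocalRing.closedPoint _), rfl⟩⟩
  refine ⟨f.toRationalMap, inferInstance, inferInstance, fun g => ?_⟩
  obtain ⟨σ, hσb, hσa⟩ := hG g
  -- Equality of rational maps is tested at the generic point, and there after the extension `i`,
  -- where `σ` describes both actions.
  refine Scheme.RationalMap.eq_of_fromFunctionField_eq _ _ ?_
  change (f.isoComp (b.act g)).fromFunctionField = (f.compHom (a.act g).hom).fromFunctionField
  have hi := isDensePoint_specMap_fromSpecStalk (Y := Y) i
  have key : f.evalPoint (hi.comp_iso (b.act g)) =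
      Spec.map (CommRingCat.ofHom σ) ≫ f.evalPoint hi := by
    rw [← Scheme.PartialMap.evalPoint_specMap]
    congr 1
    rw [Category.assoc, hσb]
  rw [← cancel_epi (Spec.map (CommRingCat.ofHom i)),
    ← Scheme.PartialMap.evalPoint_functionField, ← Scheme.PartialMap.evalPoint_functionField,
    Scheme.PartialMap.evalPoint_isoComp, Scheme.PartialMap.evalPoint_compHom, key,
    Scheme.PartialMap.evalPoint_functionField, hf, hτ, Category.assoc, hσa]

end

/-! ### Field-valued points of projective space and its function field. -/

noncomputable section

namespace ProjDual

variable {k : Type u} [Field k] {V : Type u} [AddCommGroup V] [Module k V]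
  {Ω : Type u} [Field Ω] [Algebra k Ω] {φ : SymmetricAlgebra k V →ₐ[k] Ω}

/-- The evaluation of degree zero fractions with denominators powers of `s` in a field. -/
def awayToField (φ : SymmetricAlgebra k V →ₐ[k] Ω) (s : SymmetricAlgebra k V) (hs : φ s ≠ 0) :
    HomogeneousLocalization.Away (SymProj.grading k V) s →+* Ω :=
  (IsLocalization.Away.lift (S := Localization.Away s) s (g := (φ : SymmetricAlgebra k V →+* Ω))
    (IsUnit.mk0 _ hs)).comp
    (algebraMap (HomogeneousLocalization.Away (SymProj.grading k V) s) (Localization.Away s))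

theorem awayToField_homogeneousLocalization_mk (φ : SymmetricAlgebra k V →ₐ[k] Ω)
    (s : SymmetricAlgebra k V) (hs : φ s ≠ 0)
    (c : HomogeneousLocalization.NumDenSameDeg (SymProj.grading k V) (Submonoid.powers s)) :
    awayToField φ s hs (HomogeneousLocalization.mk c) = φ c.num / φ c.den := by
  have hden : φ (c.den : SymmetricAlgebra k V) ≠ 0 := by
    obtain ⟨n, hn⟩ := c.den_mem
    rw [← hn, map_pow]
    exact pow_ne_zero _ hs
  rw [eq_div_iff hden]
  let F := IsLocalization.Away.lift (S := Localization.Away s) s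
    (g := (φ : SymmetricAlgebra k V →+* Ω)) (IsUnit.mk0 _ hs)
  have hF : ∀ x, F (algebraMap _ _ x) = φ x := fun x =>
    IsLocalization.Away.lift_eq (S := Localization.Away s) s
      (g := (φ : SymmetricAlgebra k V →+* Ω)) (IsUnit.mk0 _ hs) x
  change F (HomogeneousLocalization.mk c).val * _ = _
  rw [← hF, ← hF, ← map_mul, HomogeneousLocalization.val_mk, Localization.mk_eq_mk']
  congr 1
  exact IsLocalization.mk'_spec (Localization.Away s) _
    (⟨c.den, c.den_mem⟩ : Submonoid.powers s)

theorem awayToField_mk (φ : SymmetricAlgebra k V →ₐ[k] Ω) (s : SymmetricAlgebra k V)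
    (hs : φ s ≠ 0) {i : ℕ} (hi : s ∈ SymProj.grading k V i) (n : ℕ) (x : SymmetricAlgebra k V)
    (hx : x ∈ SymProj.grading k V (n • i)) :
    awayToField φ s hs (HomogeneousLocalization.Away.mk _ hi n x hx) = φ x / φ s ^ n := by
  rw [HomogeneousLocalization.Away.mk, awayToField_homogeneousLocalization_mk, map_pow]

/-- The point of `ℙ(V^∨)` with values in a field `Ω` given by a homomorphism `Sym V → Ω`,
in the chart where the homogeneous element `s` does not vanish. -/
def fieldPoint (φ : SymmetricAlgebra k V →ₐ[k] Ω) (s : SymmetricAlgebra k V) (hs : φ s ≠ 0)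
    {i : ℕ} (hi : s ∈ SymProj.grading k V i) (h0 : 0 < i) : Spec (.of Ω) ⟶ ProjDual k V :=
  Spec.map (CommRingCat.ofHom (awayToField φ s hs)) ≫ Proj.awayι (SymProj.grading k V) s hi h0

theorem fieldPoint_mul (φ : SymmetricAlgebra k V →ₐ[k] Ω) (s t : SymmetricAlgebra k V)
    (hs : φ s ≠ 0) {i : ℕ} (hi : s ∈ SymProj.grading k V i) (h0 : 0 < i) {j : ℕ}
    (hj : t ∈ SymProj.grading k V j) (hst : φ (s * t) ≠ 0)
    (x : SymmetricAlgebra k V) (hx : x = s * t) (hφx : φ x ≠ 0)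
    {l : ℕ} (hl : x ∈ SymProj.grading k V l) (hl0 : 0 < l) (hlij : l = i + j) :
    fieldPoint φ x hφx hl hl0 = fieldPoint φ s hs hi h0 := by
  subst hlij
  rw [fieldPoint, fieldPoint, ← Proj.SpecMap_awayMap_awayι (SymProj.grading k V) hi h0 hj hx,
    ← Spec.map_comp_assoc, ← CommRingCat.ofHom_comp]
  congr 3
  ext y
  obtain ⟨n, y, hy, rfl⟩ := y.mk_surjective _ hi
  rw [RingHom.comp_apply, HomogeneousLocalization.awayMap_mk, awayToField_mk, awayToField_mk]
  subst hx
  rw [map_mul, map_mul, map_pow, mul_pow]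
  rw [map_mul] at hst
  field_simp [right_ne_zero_of_mul hst]

/-- Both charts restrict to the chart of `s * t`, where the point is given by the same quotients.
The point therefore depends on `φ` alone. -/
theorem fieldPoint_congr (φ : SymmetricAlgebra k V →ₐ[k] Ω) (s t : SymmetricAlgebra k V)
    (hs : φ s ≠ 0) {i : ℕ} (hi : s ∈ SymProj.grading k V i) (h0 : 0 < i) (ht : φ t ≠ 0) {j : ℕ}
    (hj : t ∈ SymProj.grading k V j) (hj0 : 0 < j) :
    fieldPoint φ s hs hi h0 = fieldPoint φ t ht hj hj0 := by
  have hst : φ (s * t) ≠ 0 := by rw [map_mul]; exact mul_ne_zero hs ht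
  rw [← fieldPoint_mul φ s t hs hi h0 hj hst _ rfl hst (SetLike.mul_mem_graded hi hj)
      (by omega) rfl,
    ← fieldPoint_mul φ t s ht hj hj0 hi (by rwa [mul_comm]) _ (mul_comm s t) hst
      (SetLike.mul_mem_graded hi hj) (by omega) (add_comm _ _)]

theorem fieldPoint_map (φ : SymmetricAlgebra k V →ₐ[k] Ω) (f : V →ₗ[k] V) (hf)
    (s : SymmetricAlgebra k V) {i : ℕ} (hi : s ∈ SymProj.grading k V i) (h0 : 0 < i)
    (ψ : SymmetricAlgebra k V →ₐ[k] Ω) (hψ : ∀ x, ψ x = φ (SymProj.symMap f x))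
    (hs : φ (SymProj.symMap f s) ≠ 0) (hs' : ψ s ≠ 0) :
    fieldPoint φ (SymProj.symMap f s) hs ((SymProj.symMap f).map_mem hi) h0 ≫
      (Proj.map (SymProj.symMap f) hf : ProjDual k V ⟶ ProjDual k V) = fieldPoint ψ s hs' hi h0 := by
  rw [fieldPoint, Category.assoc, Proj.awayι_comp_map _ _ h0 _ hi, ← Spec.map_comp_assoc,
    ← CommRingCat.ofHom_comp, fieldPoint]
  congr 3
  ext y
  obtain ⟨n, y, hy, rfl⟩ := y.mk_surjective _ hi
  rw [RingHom.comp_apply, HomogeneousLocalization.Away.map_mk, awayToField_mk, awayToField_mk,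
    hψ, hψ]

theorem specMap_fieldPoint {Ω' : Type u} [Field Ω'] [Algebra k Ω']
    (φ : SymmetricAlgebra k V →ₐ[k] Ω) (σ : Ω →+* Ω')
    (s : SymmetricAlgebra k V) {i : ℕ} (hi : s ∈ SymProj.grading k V i) (h0 : 0 < i)
    (ψ : SymmetricAlgebra k V →ₐ[k] Ω') (hψ : ∀ x, ψ x = σ (φ x))
    (hs : φ s ≠ 0) (hs' : ψ s ≠ 0) :
    Spec.map (CommRingCat.ofHom σ) ≫ fieldPoint φ s hs hi h0 = fieldPoint ψ s hs' hi h0 := by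
  rw [fieldPoint, ← Spec.map_comp_assoc, ← CommRingCat.ofHom_comp, fieldPoint]
  congr 3
  ext y
  obtain ⟨n, y, hy, rfl⟩ := y.mk_surjective _ hi
  rw [RingHom.comp_apply, awayToField_mk, awayToField_mk, hψ, hψ, map_div₀, map_pow]

theorem fieldPoint_over (φ : SymmetricAlgebra k V →ₐ[k] Ω) (s : SymmetricAlgebra k V)
    (hs : φ s ≠ 0) {i : ℕ} (hi : s ∈ SymProj.grading k V i) (h0 : 0 < i) :
    fieldPoint φ s hs hi h0 ≫ (ProjDual k V ↘ Spec (.of k)) =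
      Spec.map (CommRingCat.ofHom (algebraMap k Ω)) := by
  change (_ ≫ _) ≫ Proj.toSpecZero _ ≫ _ = _
  rw [Category.assoc, Proj.awayι_toSpecZero_assoc, ← Spec.map_comp, ← Spec.map_comp,
    ← CommRingCat.ofHom_comp, ← CommRingCat.ofHom_comp]
  congr 2
  ext c
  refine (awayToField_homogeneousLocalization_mk φ s hs
    ⟨0, algebraMap k (SymProj.grading k V 0) c, 1, one_mem _⟩).trans ?_
  refine (congrArg₂ (· / ·) (φ.commutes c) (map_one φ)).trans (div_one _)

/-- Every nonempty open contains some `D₊(r)` with `r ≠ 0` homogeneous, and injectivity gives `φ r ≠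
0`. -/
theorem isDensePoint_fieldPoint [Nontrivial V] (φ : SymmetricAlgebra k V →ₐ[k] Ω)
    (hφ : Function.Injective φ) (s : SymmetricAlgebra k V) (hs : φ s ≠ 0) {i : ℕ}
    (hi : s ∈ SymProj.grading k V i) (h0 : 0 < i) : IsDensePoint (fieldPoint φ s hs hi h0) := by
  rintro p U ⟨x, hx⟩
  obtain ⟨_, ⟨f, rfl⟩, hxf, hfU⟩ :=
    TopologicalSpace.Opens.isBasis_iff_nbhd.1 (Proj.isBasis_basicOpen (SymProj.grading k V)) hx
  rw [Proj.basicOpen_eq_iSup_proj] at hxf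
  obtain ⟨n, hn⟩ := TopologicalSpace.Opens.mem_iSup.1 hxf
  set r := GradedRing.proj (SymProj.grading k V) n f with hr
  have hr0 : r ≠ 0 := by
    intro h
    rw [h, Proj.basicOpen_zero] at hn
    exact hn
  have hrn : r ∈ SymProj.grading k V n := SetLike.coe_mem _
  -- The component `r` may have degree zero; multiplying by `s` yields positive degree and hence a
  -- standard chart.
  have hrs : φ (r * s) ≠ 0 := by
    rw [map_mul]
    exact mul_ne_zero ((map_ne_zero_iff φ hφ).2 hr0) hs
  rw [fieldPoint_congr φ s (r * s) hs hi h0 hrs (SetLike.mul_mem_graded hrn hi) (by omega),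
    fieldPoint, Scheme.Hom.comp_apply]
  have h1 : Proj.basicOpen (SymProj.grading k V) (r * s) ≤ U := by
    refine le_trans ?_ hfU
    rw [Proj.basicOpen_eq_iSup_proj _ f]
    exact (Proj.basicOpen_mono _ _ _ (Dvd.intro _ rfl)).trans (le_iSup_of_le n le_rfl)
  apply h1
  rw [← Proj.opensRange_awayι _ _ (SetLike.mul_mem_graded hrn hi) (by omega)]
  exact ⟨_, rfl⟩

instance isReduced : IsReduced (ProjDual k V) := by
  have : ∀ i, IsReduced ((Proj.affineOpenCover (SymProj.grading k V)).openCover.X i) := by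
    intro i
    have : _root_.IsReduced (HomogeneousLocalization.Away (SymProj.grading k V)
        (i.2 : SymmetricAlgebra k V)) :=
      isReduced_of_injective (algebraMap _ (Localization.Away (i.2 : SymmetricAlgebra k V)))
        (HomogeneousLocalization.val_injective _)
    exact inferInstanceAs (IsReduced (Spec (.of (HomogeneousLocalization.Away
      (SymProj.grading k V) (i.2 : SymmetricAlgebra k V)))))
  exact IsReduced.of_openCover _ (Proj.affineOpenCover (SymProj.grading k V)).openCover

theorem ι_injective : Function.Injective (SymmetricAlgebra.ι k V) := by
  refine (injective_iff_map_eq_zero _).2 fun v hv => ?_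
  refine (Module.forall_dual_apply_eq_zero_iff k v).1 fun f => ?_
  rw [← SymmetricAlgebra.lift_ι_apply (f := f) v, hv, map_zero]

/-- The point defined by the fraction field of `Sym V` lies in every nonempty open, so any two of
them meet. -/
instance irreducibleSpace [Nontrivial V] : IrreducibleSpace (ProjDual k V) := by
  obtain ⟨v, hv⟩ := exists_ne (0 : V)
  let φ : SymmetricAlgebra k V →ₐ[k] FractionRing (SymmetricAlgebra k V) :=
    IsScalarTower.toAlgHom k _ _
  have hφ : Function.Injective φ := IsFractionRing.injective _ _
  have hs : φ (SymmetricAlgebra.ι k V v) ≠ 0 :=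
    (map_ne_zero_iff φ hφ).2 ((map_ne_zero_iff _ ι_injective).2 hv)
  have hd := isDensePoint_fieldPoint φ hφ _ hs (SymProj.ι_mem_grading_one k V v) one_pos
  let p : Spec (.of (FractionRing (SymmetricAlgebra k V))) :=
    IsLocalRing.closedPoint (FractionRing (SymmetricAlgebra k V))
  have : PreirreducibleSpace (ProjDual k V) :=
    ⟨fun U W hU hW ⟨x, _, hx⟩ ⟨y, _, hy⟩ =>
      ⟨_, trivial, hd p ⟨U, hU⟩ ⟨x, hx⟩, hd p ⟨W, hW⟩ ⟨y, hy⟩⟩⟩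
  exact { toNonempty := ⟨fieldPoint φ _ hs (SymProj.ι_mem_grading_one k V v) one_pos p⟩ }

instance isIntegral [Nontrivial V] : IsIntegral (ProjDual k V) :=
  isIntegral_of_irreducibleSpace_of_isReduced _

/-- The point of `ℙ(V^∨)` with values in a field `Ω` given by a homomorphism `Sym V → Ω` not
vanishing at the linear form `v`. -/
def linearPoint (φ : SymmetricAlgebra k V →ₐ[k] Ω) (v : V) (hv : φ (SymmetricAlgebra.ι k V v) ≠ 0) :
    Spec (.of Ω) ⟶ ProjDual k V :=
  fieldPoint φ _ hv (SymProj.ι_mem_grading_one k V v) one_pos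

theorem specMap_linearPoint {Ω' : Type u} [Field Ω'] [Algebra k Ω']
    (φ : SymmetricAlgebra k V →ₐ[k] Ω) (σ : Ω →ₐ[k] Ω')
    (ψ : SymmetricAlgebra k V →ₐ[k] Ω') (hψ : ∀ v, ψ (SymmetricAlgebra.ι k V v) =
      σ (φ (SymmetricAlgebra.ι k V v)))
    (v : V) (hv : φ (SymmetricAlgebra.ι k V v) ≠ 0) (hv' : ψ (SymmetricAlgebra.ι k V v) ≠ 0) :
    Spec.map (CommRingCat.ofHom σ.toRingHom) ≫ linearPoint φ v hv = linearPoint ψ v hv' := by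
  have h : ψ = σ.comp φ := SymmetricAlgebra.algHom_ext (LinearMap.ext hψ)
  exact specMap_fieldPoint φ σ.toRingHom _ _ _ ψ (fun x => by rw [h]; rfl) hv hv'

theorem specMap_linearPoint_eq_comp (φ : SymmetricAlgebra k V →ₐ[k] Ω) (σ : Ω →ₐ[k] Ω)
    (f g : V →ₗ[k] V) (hfg : f ∘ₗ g = LinearMap.id) (hgf : g ∘ₗ f = LinearMap.id)
    (hσ : ∀ v, σ (φ (SymmetricAlgebra.ι k V v)) = φ (SymmetricAlgebra.ι k V (f v)))
    (v : V) (hv : φ (SymmetricAlgebra.ι k V v) ≠ 0) :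
    Spec.map (CommRingCat.ofHom σ.toRingHom) ≫ linearPoint φ v hv =
      linearPoint φ v hv ≫ (autOfInverse f g hfg hgf).hom := by
  let ψ : SymmetricAlgebra k V →ₐ[k] Ω :=
    φ.comp (SymmetricAlgebra.lift (SymmetricAlgebra.ι k V ∘ₗ f))
  have hψv : ψ (SymmetricAlgebra.ι k V v) = σ (φ (SymmetricAlgebra.ι k V v)) := by
    simp [ψ, hσ]
  have hψ0 : ψ (SymmetricAlgebra.ι k V v) ≠ 0 := by
    rw [hψv]
    exact (map_ne_zero_iff σ σ.injective).2 hv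
  rw [specMap_linearPoint φ σ ψ (fun v => by simp [ψ, hσ]) v hv hψ0, linearPoint, linearPoint]
  have hfv : φ (SymProj.symMap f (SymmetricAlgebra.ι k V v)) ≠ 0 := hψ0
  rw [fieldPoint_congr φ _ (SymProj.symMap f (SymmetricAlgebra.ι k V v)) hv _ one_pos hfv
    ((SymProj.symMap f).map_mem (SymProj.ι_mem_grading_one k V v)) one_pos]
  exact (fieldPoint_map φ f _ _ _ _ ψ (fun x => rfl) hfv hψ0).symm

/-- The function field of `ℙ(V^∨)` contains the ratios of linear forms. -/
theorem adjoin_ratios_le_range [Nontrivial V] (φ : SymmetricAlgebra k V →ₐ[k] Ω)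
    (v : V) (hv : φ (SymmetricAlgebra.ι k V v) ≠ 0)
    (j : (ProjDual k V).functionField →+* Ω)
    (hj : Spec.map (CommRingCat.ofHom j) ≫ (ProjDual k V).fromSpecStalk (genericPoint _) =
      linearPoint φ v hv) (x : Ω)
    (hx : x ∈ IntermediateField.adjoin k {y | ∃ w w', φ (SymmetricAlgebra.ι k V w') ≠ 0 ∧
      y = φ (SymmetricAlgebra.ι k V w) / φ (SymmetricAlgebra.ι k V w')}) : x ∈ j.range := by
  have hratio : ∀ w w', φ (SymmetricAlgebra.ι k V w') ≠ 0 →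
      φ (SymmetricAlgebra.ι k V w) / φ (SymmetricAlgebra.ι k V w') ∈ j.range := by
    intro w w' hw'
    have hm := SymProj.ι_mem_grading_one k V w'
    let a := Proj.awayι (SymProj.grading k V) _ hm one_pos
    have hgen : Set.range ((ProjDual k V).fromSpecStalk (genericPoint _)) ⊆ Set.range a := by
      have hd := isDensePoint_specMap_fromSpecStalk (Y := ProjDual k V)
        (RingHom.id (ProjDual k V).functionField)
      rw [CommRingCat.ofHom_id, Spec.map_id, Category.id_comp] at hd
      rintro _ ⟨p, rfl⟩
      refine hd p a.opensRange ?_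
      exact ⟨_, ⟨Spec.map (CommRingCat.ofHom (awayToField φ _ hw'))
        (IsLocalRing.closedPoint Ω), rfl⟩⟩
    -- The generic point factors through the chart of `w'`, so the coordinate ratio on that chart
    -- defines an element of the function field.
    let c' := IsOpenImmersion.lift a ((ProjDual k V).fromSpecStalk (genericPoint _)) hgen
    have hc' : c' ≫ a = (ProjDual k V).fromSpecStalk (genericPoint _) :=
      IsOpenImmersion.lift_fac _ _ _
    obtain ⟨c, hc⟩ := Spec.map_surjective c'
    have h1 : (Spec.map (CommRingCat.ofHom j) ≫ Spec.map c) ≫ a =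
        Spec.map (CommRingCat.ofHom (awayToField φ _ hw')) ≫ a := by
      rw [Category.assoc, hc, hc', hj, linearPoint]
      exact fieldPoint_congr φ _ _ hv _ _ hw' _ _
    rw [cancel_mono, ← Spec.map_comp] at h1
    have h2 := Spec.map_injective h1
    refine ⟨c.hom (HomogeneousLocalization.Away.mk _ hm 1 (SymmetricAlgebra.ι k V w)
      (by simpa using SymProj.ι_mem_grading_one k V w)), ?_⟩
    have h3 := congrArg (fun F => F.hom (HomogeneousLocalization.Away.mk _ hm 1
      (SymmetricAlgebra.ι k V w) (by simpa using SymProj.ι_mem_grading_one k V w))) h2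
    refine Eq.trans h3 ?_
    refine (awayToField_mk φ _ hw' hm 1 _ _).trans ?_
    rw [pow_one]
  induction hx using IntermediateField.adjoin_induction with
  | mem x hx => obtain ⟨w, w', hw', rfl⟩ := hx; exact hratio w w' hw'
  | algebraMap c =>
    have := hratio (c • v) v hv
    rwa [map_smul, map_smul, Algebra.smul_def, mul_div_cancel_right₀ _ hv] at this
  | add x y _ _ hx hy => exact add_mem hx hy
  | inv x _ hx =>
    obtain ⟨y, rfl⟩ := hx
    exact ⟨y⁻¹, map_inv₀ j y⟩
  | mul x y _ _ hx hy => exact mul_mem hx hy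

end ProjDual
end

/-! ### Function fields of representations and equivariant generic points. -/

noncomputable section

/-- The action on `Sym U` by algebra automorphisms induced by a representation on `U`. -/
def Representation.symAut {k E U : Type*} [Field k] [Group E] [AddCommGroup U] [Module k U]
    (ρ : Representation k E U) :
    E →* (SymmetricAlgebra k U ≃ₐ[k] SymmetricAlgebra k U) :=
  (AlgEquiv.algHomUnitsEquiv k (SymmetricAlgebra k U)).toMonoidHom.comp
    (MonoidHom.toHomUnits
      { toFun := fun e => SymmetricAlgebra.lift (SymmetricAlgebra.ι k U ∘ₗ ρ e)
        map_one' := by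
          apply SymmetricAlgebra.algHom_ext
          ext v
          simp
        map_mul' := fun g h => by
          apply SymmetricAlgebra.algHom_ext
          ext v
          simp })

theorem Representation.symAut_ι {k E U : Type*} [Field k] [Group E] [AddCommGroup U] [Module k U]
    (ρ : Representation k E U) (e : E) (v : U) :
    ρ.symAut e (SymmetricAlgebra.ι k U v) = SymmetricAlgebra.ι k U (ρ e v) :=
  SymmetricAlgebra.lift_ι_apply (f := SymmetricAlgebra.ι k U ∘ₗ ρ e) v

/-- The field of rational functions on the dual of a representation. -/
theorem Representation.exists_rationalFunctionField {k E U : Type u} [Field k] [Group E]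
    [AddCommGroup U] [Module k U] (ρ : Representation k E U) :
    ∃ (Ω : Type u) (_ : Field Ω) (_ : Algebra k Ω) (σ : E →* (Ω ≃ₐ[k] Ω)) (l : U →ₗ[k] Ω),
      (∀ e v, σ e (l v) = l (ρ e v)) ∧
      ∀ {J : Type u} (b : Module.Basis J k U), AlgebraicIndependent k (fun i => l (b i)) ∧
        IntermediateField.adjoin k (Set.range fun i => l (b i)) = ⊤ := by
  let A := SymmetricAlgebra k U
  let Ω := FractionRing A
  refine ⟨Ω, inferInstance, inferInstance,
    (IsFractionRing.fieldEquivOfAlgEquivHom (A := k) (B := A) k Ω).comp ρ.symAut,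
    (IsScalarTower.toAlgHom k A Ω).toLinearMap ∘ₗ SymmetricAlgebra.ι k U, fun e v => ?_, ?_⟩
  · refine (IsFractionRing.fieldEquivOfAlgEquiv_algebraMap k Ω Ω (ρ.symAut e) _).trans ?_
    rw [ρ.symAut_ι]
    rfl
  · intro J b
    let F : MvPolynomial J k →ₐ[k] Ω := (IsScalarTower.toAlgHom k A Ω).comp
      (SymmetricAlgebra.equivMvPolynomial b).symm.toAlgHom
    have hF : ∀ i, F (MvPolynomial.X i) = algebraMap A Ω (SymmetricAlgebra.ι k U (b i)) :=
      fun i => congrArg (algebraMap A Ω) (SymmetricAlgebra.equivMvPolynomial_symm_X b i)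
    have hFa : F = MvPolynomial.aeval fun i => algebraMap A Ω (SymmetricAlgebra.ι k U (b i)) :=
      MvPolynomial.algHom_ext fun i => by rw [hF, MvPolynomial.aeval_X]
    constructor
    · rw [AlgebraicIndependent]
      change Function.Injective (MvPolynomial.aeval
        fun i => algebraMap A Ω (SymmetricAlgebra.ι k U (b i)))
      rw [← hFa]
      exact (IsFractionRing.injective A Ω).comp (SymmetricAlgebra.equivMvPolynomial b).symm.injective
    · refine eq_top_iff.2 fun x _ => ?_
      have hA : ∀ y : A, algebraMap A Ω y ∈ IntermediateField.adjoin k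
          (Set.range fun i => algebraMap A Ω (SymmetricAlgebra.ι k U (b i))) := by
        intro y
        obtain ⟨p, rfl⟩ := (SymmetricAlgebra.equivMvPolynomial b).symm.surjective y
        change F p ∈ _
        rw [hFa]
        refine IntermediateField.algebra_adjoin_le_adjoin k _ ?_
        rw [Algebra.adjoin_range_eq_range_aeval]
        exact ⟨p, rfl⟩
      obtain ⟨y, z, -, rfl⟩ := IsFractionRing.div_surjective A x
      exact div_mem (hA y) (hA z)

theorem SymmetricAlgebra.lift_injective {k U Ω J : Type*} [Field k] [AddCommGroup U] [Module k U]
    [Field Ω] [Algebra k Ω] (l : U →ₗ[k] Ω) (b : Module.Basis J k U)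
    (h : AlgebraicIndependent k fun i => l (b i)) :
    Function.Injective (SymmetricAlgebra.lift l) := by
  have : SymmetricAlgebra.lift l = (MvPolynomial.aeval fun i => l (b i)).comp
      (SymmetricAlgebra.equivMvPolynomial b).toAlgHom := by
    apply SymmetricAlgebra.algHom_ext
    refine b.ext fun i => ?_
    simp
  rw [this]
  exact (show Function.Injective (MvPolynomial.aeval fun i => l (b i)) from h).comp
    (SymmetricAlgebra.equivMvPolynomial b).injective

/-- All homogeneous elements of positive degree vanish, so every chart is empty. This rules out `V =
0` as the source of a dominant map. -/
theorem ProjDual.isEmpty_of_subsingleton {k V : Type u} [Field k] [AddCommGroup V] [Module k V]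
    [Subsingleton V] : IsEmpty (ProjDual k V) := by
  refine ⟨fun x => ?_⟩
  obtain ⟨⟨n, s⟩, y, -⟩ := (Proj.affineOpenCover (SymProj.grading k V)).openCover.exists_eq x
  have hs : (s : SymmetricAlgebra k V) = 0 := by
    have h1 : (s : SymmetricAlgebra k V) ∈ LinearMap.range (SymmetricAlgebra.ι k V) ^ (n : ℕ) := s.2
    have h2 : LinearMap.range (SymmetricAlgebra.ι k V) = ⊥ := by
      rw [LinearMap.range_eq_bot]
      ext v
      rw [Subsingleton.elim v 0, map_zero, map_zero]
    have h3 : ∀ m : ℕ, 0 < m → LinearMap.range (SymmetricAlgebra.ι k V) ^ m = ⊥ := by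
      rintro (_ | m) hm
      · exact absurd hm (lt_irrefl 0)
      · rw [pow_succ, h2, Submodule.mul_bot]
    exact (Submodule.mem_bot k).1 (h3 n n.2 ▸ h1)
  have : Subsingleton (HomogeneousLocalization.Away (SymProj.grading k V)
      (s : SymmetricAlgebra k V)) := by
    rw [hs]
    exact HomogeneousLocalization.subsingleton _ ⟨1, by simp⟩
  exact (PrimeSpectrum.isEmpty_iff_subsingleton.2 this).false y

/-- Scalars act trivially on projective space. The two groups may differ, which allows comparison of
lifts of one projective representation to different central extensions. -/
theorem ProjDual.action_act_eq_of_smul {k : Type u} [Field k] {G H : Type u} [Group G] [Group H]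
    {V : Type u} [AddCommGroup V] [Module k V] (ρ : Representation k G V)
    (ρ' : Representation k H V) (g : G) (h : H) (c : kˣ) (hc : ρ g = (c : k) • ρ' h) :
    (ProjDual.action ρ).act g = (ProjDual.action ρ').act h := by
  ext1
  have e : ρ g = ρ' h ∘ₗ ((c : k) • LinearMap.id) := by rw [hc]; ext; simp
  have hi := SymProj.irrelevant_le ((c : k) • LinearMap.id : V →ₗ[k] V)
    (((c⁻¹ : kˣ) : k) • LinearMap.id) (by ext; simp [smul_smul])
  change Proj.map (SymProj.symMap (ρ g)) _ = Proj.map (SymProj.symMap (ρ' h)) _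
  simp only [e, SymProj.symMap_comp]
  rw [Proj.map_comp _ _ hi (SymProj.irrelevant_le (ρ' h) (ρ' h⁻¹)
    (by rw [← Module.End.mul_eq_comp, ← map_mul, mul_inv_cancel, map_one]; rfl)),
    map_smul_id, Category.comp_id]

theorem ProjDual.specMap_linearPoint_action {k : Type u} [Field k] {G : Type u} [Group G]
    {V : Type u} [AddCommGroup V] [Module k V] {Ω : Type u} [Field Ω] [Algebra k Ω]
    (φ : SymmetricAlgebra k V →ₐ[k] Ω) (σ : Ω →ₐ[k] Ω) (ρ : Representation k G V) (g : G)
    (hσ : ∀ v, σ (φ (SymmetricAlgebra.ι k V v)) = φ (SymmetricAlgebra.ι k V (ρ g v)))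
    (v : V) (hv : φ (SymmetricAlgebra.ι k V v) ≠ 0) :
    Spec.map (CommRingCat.ofHom σ.toRingHom) ≫ linearPoint φ v hv =
      linearPoint φ v hv ≫ ((ProjDual.action ρ).act g).hom :=
  specMap_linearPoint_eq_comp φ σ (ρ g) (ρ g⁻¹)
    (by rw [← Module.End.mul_eq_comp, ← map_mul, mul_inv_cancel, map_one]; rfl)
    (by rw [← Module.End.mul_eq_comp, ← map_mul, inv_mul_cancel, map_one]; rfl) hσ v hv

/-- A field-valued generic point of `X`, equivariant for an action of `E` on the field. -/
structure IsEquivariantPoint {k : Type u} [Field k] {E : Type u} [Group E] {X : Scheme.{u}}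
    [X.Over (Spec (.of k))] [IsIntegral X] (a : RightAction (Spec (.of k)) E X)
    {Ω : Type u} [Field Ω] [Algebra k Ω] (σ : E → Ω →+* Ω) (j : X.functionField →+* Ω) : Prop where
  comp_over : Spec.map (CommRingCat.ofHom j) ≫ X.fromSpecStalk (genericPoint X) ≫ (X ↘ Spec (.of k)) =
    Spec.map (CommRingCat.ofHom (algebraMap k Ω))
  equivariant : ∀ e, Spec.map (CommRingCat.ofHom (σ e)) ≫ Spec.map (CommRingCat.ofHom j) ≫
      X.fromSpecStalk (genericPoint X) =
    Spec.map (CommRingCat.ofHom j) ≫ X.fromSpecStalk (genericPoint X) ≫ (a.act e).hom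

namespace IsEquivariantPoint

variable {k : Type u} [Field k] {E : Type u} [Group E] {X : Scheme.{u}}
  [X.Over (Spec (.of k))] [IsIntegral X] {a : RightAction (Spec (.of k)) E X}
  {Ω : Type u} [Field Ω] [Algebra k Ω] {σ : E → Ω →+* Ω} {j : X.functionField →+* Ω}

/-- The generic point is a monomorphism from the spectrum of the function field, so a trivial action
on `X` forces a trivial action on coordinates. -/
theorem apply_eq (hj : IsEquivariantPoint a σ j) (e : E) (he : a.act e = Iso.refl X)
    (x : X.functionField) : σ e (j x) = j x := by
  have h := hj.equivariant e
  rw [he, Iso.refl_hom, Category.comp_id, ← Category.assoc, cancel_mono, ← Spec.map_comp] at h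
  exact congrArg (fun F => F.hom x) (Spec.map_injective h)

theorem of_comp {K : Type u} [Field K] [Algebra k K] (i : K →ₐ[k] Ω) {s : E → K →+* K}
    (hs : ∀ e x, i (s e x) = σ e (i x)) {j : X.functionField →+* K}
    (hj : IsEquivariantPoint a σ ((i : K →+* Ω).comp j)) : IsEquivariantPoint a s j where
  comp_over := by
    rw [← cancel_epi (Spec.map (CommRingCat.ofHom (i : K →+* Ω))), ← Spec.map_comp_assoc,
      ← CommRingCat.ofHom_comp, hj.comp_over, ← Spec.map_comp, ← CommRingCat.ofHom_comp,
      i.comp_algebraMap]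
  equivariant e := by
    have h := hj.equivariant e
    have hr : Spec.map (CommRingCat.ofHom (i : K →+* Ω)) ≫ Spec.map (CommRingCat.ofHom (s e)) =
        Spec.map (CommRingCat.ofHom (σ e)) ≫ Spec.map (CommRingCat.ofHom (i : K →+* Ω)) := by
      rw [← Spec.map_comp, ← Spec.map_comp, ← CommRingCat.ofHom_comp, ← CommRingCat.ofHom_comp,
        show (i : K →+* Ω).comp (s e) = (σ e).comp (i : K →+* Ω) from RingHom.ext (hs e)]
    rw [CommRingCat.ofHom_comp, Spec.map_comp, Category.assoc, Category.assoc] at h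
    rw [← cancel_epi (Spec.map (CommRingCat.ofHom (i : K →+* Ω))), ← h, reassoc_of% hr]

theorem comp {K : Type u} [Field K] [Algebra k K] (i : K →ₐ[k] Ω) {s : E → K →+* K}
    (hs : ∀ e x, i (s e x) = σ e (i x)) {j : X.functionField →+* K}
    (hj : IsEquivariantPoint a s j) : IsEquivariantPoint a σ ((i : K →+* Ω).comp j) where
  comp_over := by
    rw [CommRingCat.ofHom_comp, Spec.map_comp, Category.assoc, hj.comp_over, ← Spec.map_comp,
      ← CommRingCat.ofHom_comp, i.comp_algebraMap]
  equivariant e := by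
    have hr : Spec.map (CommRingCat.ofHom (i : K →+* Ω)) ≫ Spec.map (CommRingCat.ofHom (s e)) =
        Spec.map (CommRingCat.ofHom (σ e)) ≫ Spec.map (CommRingCat.ofHom (i : K →+* Ω)) := by
      rw [← Spec.map_comp, ← Spec.map_comp, ← CommRingCat.ofHom_comp, ← CommRingCat.ofHom_comp,
        show (i : K →+* Ω).comp (s e) = (σ e).comp (i : K →+* Ω) from RingHom.ext (hs e)]
    rw [CommRingCat.ofHom_comp, Spec.map_comp, Category.assoc, Category.assoc,
      ← hj.equivariant e, reassoc_of% hr]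

/-- Twisting an equivariant point by an equivariant embedding of a subfield containing its
coordinates. -/
theorem twist (K : IntermediateField k Ω) (θ : K →ₐ[k] Ω)
    (hθ : ∀ e (x : K), ∃ h : σ e x ∈ K, θ ⟨σ e x, h⟩ = σ e (θ x))
    (hj : IsEquivariantPoint a σ j) (hjK : ∀ x, j x ∈ K) :
    IsEquivariantPoint a σ ((θ : K →+* Ω).comp (j.codRestrict K hjK)) :=
  comp θ (s := fun e => ((σ e).comp (K.val : K →+* Ω)).codRestrict K fun x => (hθ e x).1)
    (fun e x => (hθ e x).2) (of_comp K.val (fun _ _ => rfl) hj)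

/-- The coordinates of the point are rational in ratios of linear forms, hence lie in the function
field of projective space, and the point spreads out to a rational map. -/
theorem dominatesEquivariantly [LocallyOfFiniteType (X ↘ Spec (.of k))] {P : Type u}
    [AddCommGroup P] [Module k P] [Nontrivial P] (ρ : Representation k E P) (l : P →ₗ[k] Ω)
    (hl : Function.Injective (SymmetricAlgebra.lift l)) (σ : E → Ω →ₐ[k] Ω)
    (hσ : ∀ e p, σ e (l p) = l (ρ e p))
    (hj : IsEquivariantPoint a (fun e => (σ e).toRingHom) j)
    (hjl : ∀ x, j x ∈ IntermediateField.adjoin k {y | ∃ p p', l p' ≠ 0 ∧ y = l p / l p'}) :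
    DominatesEquivariantly (ProjDual.action ρ) a := by
  obtain ⟨p, hp⟩ := exists_ne (0 : P)
  have hp0 : SymmetricAlgebra.lift l (SymmetricAlgebra.ι k _ p) ≠ 0 :=
    (map_ne_zero_iff _ hl).2 ((map_ne_zero_iff _ ProjDual.ι_injective).2 hp)
  have hη : IsDensePoint (ProjDual.linearPoint (SymmetricAlgebra.lift l) p hp0) :=
    ProjDual.isDensePoint_fieldPoint _ hl _ hp0 _ _
  obtain ⟨i, hi⟩ := hη.exists_functionField_hom
  refine DominatesEquivariantly.of_densePoint _ a i j ?_ ?_ fun e =>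
    ⟨(σ e).toRingHom, ?_, hj.equivariant e⟩
  · rintro _ ⟨x, rfl⟩
    refine ProjDual.adjoin_ratios_le_range _ p hp0 i hi _ ?_
    simpa only [SymmetricAlgebra.lift_ι_apply] using hjl x
  · rw [reassoc_of% hi, hj.comp_over]
    exact ProjDual.fieldPoint_over _ _ _ _ _
  · rw [hi, reassoc_of% hi]
    exact ProjDual.specMap_linearPoint_action _ (σ e) ρ e (fun v => by simp [hσ]) p hp0

end IsEquivariantPoint

/-- The tautological point of `ℙ(V^∨)` given by `l` is dense and equivariant; the rational map
carries it to such a point of `X`. -/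
theorem DominatesEquivariantly.exists_isEquivariantPoint {k : Type u} [Field k] {E : Type u}
    [Group E] {X : Scheme.{u}} [X.Over (Spec (.of k))] [IsIntegral X]
    {a : RightAction (Spec (.of k)) E X} {V : Type u} [AddCommGroup V] [Module k V]
    {ρ : Representation k E V} (h : DominatesEquivariantly (ProjDual.action ρ) a)
    {Ω : Type u} [Field Ω] [Algebra k Ω] (σ : E → Ω →ₐ[k] Ω) (l : V →ₗ[k] Ω)
    (hl : Function.Injective (SymmetricAlgebra.lift l)) (hσ : ∀ e v, σ e (l v) = l (ρ e v)) :
    ∃ j : X.functionField →+* Ω, IsEquivariantPoint a (fun e => (σ e).toRingHom) j := by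
  obtain ⟨f', hf', hdom, heq⟩ := h
  obtain ⟨f, hfS, rfl⟩ := f'.exists_partialMap_over (Spec (.of k))
  have hdom' := f.isDominant_toRationalMap_iff.1 hdom
  -- A dominant map to the nonempty `X` cannot start from an empty scheme.
  have hV : Nontrivial V := by
    by_contra hV
    rw [not_nontrivial_iff_subsingleton] at hV
    have := ProjDual.isEmpty_of_subsingleton (k := k) (V := V)
    obtain ⟨x⟩ : Nonempty X := inferInstance
    obtain ⟨_, -, ⟨y, -⟩⟩ :=
      (IsDominant.denseRange (f := f.hom)).inter_open_nonempty Set.univ isOpen_univ ⟨x, trivial⟩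
    exact this.false (f.domain.ι y)
  obtain ⟨v, hv⟩ := exists_ne (0 : V)
  have hv0 : SymmetricAlgebra.lift l (SymmetricAlgebra.ι k _ v) ≠ 0 :=
    (map_ne_zero_iff _ hl).2 ((map_ne_zero_iff _ ProjDual.ι_injective).2 hv)
  have hη : IsDensePoint (ProjDual.linearPoint (SymmetricAlgebra.lift l) v hv0) :=
    ProjDual.isDensePoint_fieldPoint _ hl _ hv0 _ _
  obtain ⟨j, hj⟩ := (f.isDensePoint_evalPoint hη).exists_functionField_hom
  refine ⟨j, ?_, fun e => ?_⟩
  · rw [reassoc_of% hj, f.evalPoint_over hη]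
    exact ProjDual.fieldPoint_over _ _ _ _ _
  · rw [hj, reassoc_of% hj]
    exact heq.evalPoint_eq hη e _ (ProjDual.specMap_linearPoint_action _ (σ e) ρ e
      (fun v => by simp [hσ]) v hv0)

/-- The stable subfield generated by the linear forms can itself serve as the field of values, which
confines the coordinates to it. -/
theorem DominatesEquivariantly.exists_isEquivariantPoint_mem_adjoin {k : Type u} [Field k]
    {E : Type u} [Group E] {X : Scheme.{u}} [X.Over (Spec (.of k))] [IsIntegral X]
    {a : RightAction (Spec (.of k)) E X} {V : Type u} [AddCommGroup V] [Module k V]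
    {ρ : Representation k E V} (h : DominatesEquivariantly (ProjDual.action ρ) a)
    {Ω : Type u} [Field Ω] [Algebra k Ω] (σ : E → Ω →ₐ[k] Ω) (l : V →ₗ[k] Ω)
    (hl : Function.Injective (SymmetricAlgebra.lift l)) (hσ : ∀ e v, σ e (l v) = l (ρ e v)) :
    ∃ j : X.functionField →+* Ω, IsEquivariantPoint a (fun e => (σ e).toRingHom) j ∧
      ∀ x, j x ∈ IntermediateField.adjoin k (Set.range l) := by
  let M := IntermediateField.adjoin k (Set.range l)
  let lM : V →ₗ[k] M := l.codRestrict (Subalgebra.toSubmodule M.toSubalgebra) fun v =>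
    IntermediateField.subset_adjoin k _ ⟨v, rfl⟩
  have hσM : ∀ e (x : M), σ e x ∈ M := by
    intro e x
    have : M ≤ M.comap (σ e) := by
      refine IntermediateField.adjoin_le_iff.2 ?_
      rintro _ ⟨v, rfl⟩
      change σ e (l v) ∈ M
      rw [hσ]
      exact IntermediateField.subset_adjoin k _ ⟨_, rfl⟩
    exact this x.2
  have hlM : Function.Injective (SymmetricAlgebra.lift lM) := by
    have : M.val.comp (SymmetricAlgebra.lift lM) = SymmetricAlgebra.lift l := by
      apply SymmetricAlgebra.algHom_ext
      ext v
      change M.val (SymmetricAlgebra.lift lM (SymmetricAlgebra.ι k V v)) =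
        SymmetricAlgebra.lift l (SymmetricAlgebra.ι k V v)
      rw [SymmetricAlgebra.lift_ι_apply, SymmetricAlgebra.lift_ι_apply]
      rfl
    intro x y hxy
    refine hl ?_
    rw [← this]
    exact congrArg M.val hxy
  obtain ⟨j, hj⟩ := h.exists_isEquivariantPoint
    (fun e => ((σ e).comp M.val).codRestrict M.toSubalgebra (hσM e)) lM hlM
    fun e v => Subtype.ext (hσ e v)
  exact ⟨_, hj.comp M.val (fun e x => rfl), fun x => (j x).2⟩

/-- If `ℙ(V^∨)` dominates `X` equivariantly for a group `E` in which the subgroup `Z` acts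
trivially on `X`, then so does `ℙ((W^m)^∨)`, for any representation `W` on which exactly `Z` acts
by scalars, via a faithful character. -/
theorem DominatesEquivariantly.of_scalar_representation {k : Type u} [Field k] [CharZero k]
    {E : Type u} [Group E] [Finite E] {W V : Type u} [AddCommGroup W] [Module k W]
    [FiniteDimensional k W] [Nontrivial W] [AddCommGroup V] [Module k V] [FiniteDimensional k V]
    (ρW : Representation k E W) (ρV : Representation k E V) (Z : Subgroup E) (χ : Z →* kˣ)
    (hχ : Function.Injective χ) (hscal : ∀ e, (∃ c : k, ρW e = c • LinearMap.id) → e ∈ Z)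
    (hρZ : ∀ z : Z, ρW z = (χ z : k) • LinearMap.id)
    {X : Scheme.{u}} [X.Over (Spec (.of k))] [IsIntegral X]
    [LocallyOfFiniteType (X ↘ Spec (.of k))] (a : RightAction (Spec (.of k)) E X)
    (haZ : ∀ z ∈ Z, a.act z = Iso.refl X)
    (h : DominatesEquivariantly (ProjDual.action ρV) a) :
    DominatesEquivariantly (ProjDual.action (ρW.power (Module.finrank k V + 2))) a := by
  set d := Module.finrank k V with hd
  let bV : Module.Basis (Fin d) k V := Module.finBasis k V
  let I := Fin (Module.finrank k W)
  let bW : Module.Basis I k W := Module.finBasis k W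
  have : Nonempty I := Fin.pos_iff_nonempty.1 Module.finrank_pos
  let ρ : Representation k E ((Fin (d + 2) → W) × V) := (ρW.power (d + 2)).prod ρV
  obtain ⟨Ω, _, _, σ, l, hσ, hl⟩ := ρ.exists_rationalFunctionField
  let lW : Fin (d + 2) → W →ₗ[k] Ω := fun j =>
    l ∘ₗ LinearMap.inl k (Fin (d + 2) → W) V ∘ₗ LinearMap.single k (fun _ => W) j
  let lV : V →ₗ[k] Ω := l ∘ₗ LinearMap.inr k (Fin (d + 2) → W) V
  let lP : (Fin (d + 2) → W) →ₗ[k] Ω := l ∘ₗ LinearMap.inl k (Fin (d + 2) → W) V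
  have hσV : ∀ e v, σ e (lV v) = lV (ρV e v) := fun e v => by
    refine (hσ e _).trans (congrArg l ?_)
    simp [ρ]
  have hσP : ∀ e w, σ e (lP w) = lP (ρW.power (d + 2) e w) := fun e w => by
    refine (hσ e _).trans (congrArg l ?_)
    simp [ρ]
  have hσW : ∀ e j w, σ e (lW j w) = lW j (ρW e w) := fun e j w => by
    refine (hσP e _).trans (congrArg lP ?_)
    funext i
    change ρW e (Pi.single (M := fun _ => W) j w i) = Pi.single (M := fun _ => W) j (ρW e w) i
    by_cases hij : i = j
    · subst hij; simp
    · simp [hij]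
  let bP : Module.Basis (Fin (d + 2) × I) k (Fin (d + 2) → W) :=
    (Pi.basis fun _ => bW).reindex (Equiv.sigmaEquivProd _ _)
  -- The index type is lifted only to match the universe of the bases in
  -- `exists_rationalFunctionField`.
  let bU := (bP.prod bV).reindex Equiv.ulift.{u}.symm
  have hbU : (fun i => l (bU i)) = (Sum.elim (fun p : Fin (d + 2) × I => lW p.1 (bW p.2))
      fun s => lV (bV s)) ∘ Equiv.ulift := by
    funext ⟨i⟩
    rcases i with ⟨j, i⟩ | s
    · simp [bU, lW, bP]
    · simp [bU, lV]
  obtain ⟨hind, hgen⟩ := hl bU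
  rw [hbU] at hind hgen
  rw [EquivLike.range_comp] at hgen
  replace hind := (algebraicIndependent_equiv Equiv.ulift).1 hind
  obtain ⟨K, θ, hK, hθ, hθr⟩ := exists_descending_embedding σ ρW ρV Z χ hχ hscal hρZ bW bV lW lV
    hσW hσV hind hgen
  have hindV : AlgebraicIndependent k fun s => lV (bV s) :=
    hind.comp Sum.inr Sum.inr_injective
  obtain ⟨j, hj, hjV⟩ := h.exists_isEquivariantPoint_mem_adjoin (fun e => (σ e).toAlgHom) lV
    (SymmetricAlgebra.lift_injective lV bV hindV) hσV
  have hjZ : ∀ x, ∀ z ∈ Z, σ z (j x) = j x := fun x z hz => hj.apply_eq z (haZ z hz) x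
  have hjK : ∀ x, j x ∈ K := fun x => hK _ (hjV x) (hjZ x)
  have hindP : AlgebraicIndependent k fun p => lP (bP p) := by
    have hbP : (fun p => lP (bP p)) = fun p => lW p.1 (bW p.2) := by
      funext p
      simp [lP, lW, bP]
    rw [hbP]
    exact hind.comp Sum.inl Sum.inl_injective
  refine (hj.twist K θ hθ hjK).dominatesEquivariantly _ lP
    (SymmetricAlgebra.lift_injective lP bP hindP) (fun e => (σ e).toAlgHom) hσP fun x =>
      IntermediateField.adjoin.mono k _ _ ?_ (hθr _)
  rintro _ ⟨j, j', w, w', hw', rfl⟩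
  exact ⟨Pi.single j w, Pi.single j' w', hw', rfl⟩

end

/-! ### Cocycles with values in `k^×` and finiteness of the class group. -/

noncomputable section

namespace H2Units

variable {k : Type u} [Field k] {G : Type u} [Group G]

/-- A `2`-cocycle with values in `k^×`, from a multiplicatively written cocycle. -/
def mkCocycle (u : G → G → kˣ)
    (hu : ∀ g h j, u (g * h) j * u g h = u h j * u g (h * j)) :
    groupCohomology.cocycles₂ (unitsRep k G) :=
  ⟨fun p => Additive.ofMul (u p.1 p.2), (groupCohomology.mem_cocycles₂_iff _).2 fun g h j =>
    congrArg Additive.ofMul (hu g h j)⟩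

/-- The value of a `2`-cocycle, written multiplicatively. -/
def value (c : groupCohomology.cocycles₂ (unitsRep k G)) (g h : G) : kˣ :=
  Additive.toMul (α := kˣ) (c (g, h))

theorem value_mkCocycle (u : G → G → kˣ) (hu) (g h : G) : value (mkCocycle u hu) g h = u g h :=
  rfl

theorem value_mul (c : groupCohomology.cocycles₂ (unitsRep k G)) (g h j : G) :
    value c (g * h) j * value c g h = value c h j * value c g (h * j) :=
  congrArg (Additive.toMul (α := kˣ)) ((groupCohomology.mem_cocycles₂_iff _).1 c.2 g h j)

theorem ext_value {c c' : groupCohomology.cocycles₂ (unitsRep k G)}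
    (h : ∀ g h, value c g h = value c' g h) : c = c' :=
  Subtype.ext (funext fun p => congrArg Additive.ofMul (h p.1 p.2))

theorem H2π_eq_iff (c c' : groupCohomology.cocycles₂ (unitsRep k G)) :
    groupCohomology.H2π (unitsRep k G) c = groupCohomology.H2π (unitsRep k G) c' ↔
      ∃ b : G → kˣ, ∀ g h, value c g h * b (g * h) = value c' g h * (b g * b h) := by
  rw [groupCohomology.H2π_eq_iff]
  constructor
  · rintro ⟨b, hb⟩
    refine ⟨fun g => Additive.toMul (α := kˣ) (b g), fun g h => ?_⟩
    have h1 : (Additive.toMul (α := kˣ) (b h)) / Additive.toMul (α := kˣ) (b (g * h)) *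
        Additive.toMul (α := kˣ) (b g) = value c g h / value c' g h :=
      congrArg (Additive.toMul (α := kˣ)) (congrFun hb (g, h))
    rw [div_mul_eq_mul_div, div_eq_div_iff_mul_eq_mul] at h1
    rw [← h1]
    ring_nf
    rw [mul_comm, mul_comm (Additive.toMul (α := kˣ) (b g))]
  · rintro ⟨b, hb⟩
    refine ⟨fun g => Additive.ofMul (b g), funext fun p => ?_⟩
    have h1 : b p.2 / b (p.1 * p.2) * b p.1 = value c p.1 p.2 / value c' p.1 p.2 := by
      rw [div_mul_eq_mul_div, div_eq_div_iff_mul_eq_mul, hb, mul_comm, mul_comm (b p.1)]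
    exact congrArg Additive.ofMul h1

/-- Every class in `H²(G, k^×)` is represented by a cocycle with values in the roots of unity of
order dividing `|G|`. -/
theorem exists_value_pow_eq_one [IsAlgClosed k] [CharZero k] [Finite G] (γ : H2Units k G) :
    ∃ c : groupCohomology.cocycles₂ (unitsRep k G), (∀ g h, value c g h ^ Nat.card G = 1) ∧
      groupCohomology.H2π (unitsRep k G) c = γ := by
  have := Fintype.ofFinite G
  induction γ using groupCohomology.H2_induction_on with | _ c =>
  have hroot : ∀ x : kˣ, ∃ y : kˣ, y ^ Nat.card G = x := by
    intro x
    obtain ⟨y, hy⟩ := IsAlgClosed.exists_pow_nat_eq (x : k) (Nat.card_pos (α := G))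
    have hy0 : y ≠ 0 := by
      rintro rfl
      rw [zero_pow Nat.card_pos.ne'] at hy
      exact x.ne_zero hy.symm
    exact ⟨Units.mk0 y hy0, Units.ext hy⟩
  -- The product of the cocycle over its last argument is a cochain whose coboundary is the `|G|`-th
  -- power of the cocycle (`hsum`). Dividing by the coboundary of a `|G|`-th root of it leaves roots
  -- of unity.
  choose β hβ using fun g => hroot (∏ j, value c g j)
  have hsum : ∀ g h, (∏ j, value c (g * h) j) * value c g h ^ Nat.card G =
      (∏ j, value c h j) * ∏ j, value c g j := by
    intro g h
    rw [← Equiv.prod_comp (Equiv.mulLeft h) (value c g), ← Finset.prod_mul_distrib,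
      Nat.card_eq_fintype_card, ← Finset.card_univ, ← Finset.prod_const, ← Finset.prod_mul_distrib]
    exact Finset.prod_congr rfl fun j _ => value_mul c g h j
  refine ⟨mkCocycle (fun g h => value c g h * (β (g * h) / (β g * β h))) ?_, ?_, ?_⟩
  · intro g h j
    have h1 := value_mul c g h j
    rw [mul_mul_mul_comm, h1, mul_mul_mul_comm (value c h j) (β (h * j) / _),
      mul_assoc g h j]
    congr 1
    rw [div_mul_div_comm, div_mul_div_comm, div_eq_div_iff_mul_eq_mul]
    simp only [mul_comm, mul_left_comm]
  · intro g h
    rw [value_mkCocycle, mul_pow, div_pow, mul_pow, hβ, hβ, hβ, ← mul_div_assoc, div_eq_one,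
      mul_comm, hsum, mul_comm]
  · rw [H2π_eq_iff]
    refine ⟨fun g => (β g)⁻¹ , fun g h => ?_⟩
    rw [value_mkCocycle, ← mul_inv]
    rw [mul_assoc, div_mul_eq_mul_div, mul_inv_cancel, one_div]

/-- Only finitely many cocycles take values in the `|G|`-th roots of unity, and they represent every
class. -/
instance finite [IsAlgClosed k] [CharZero k] [Finite G] : Finite (H2Units k G) := by
  let S := {c : groupCohomology.cocycles₂ (unitsRep k G) // ∀ g h, value c g h ^ Nat.card G = 1}
  have : NeZero (Nat.card G) := ⟨Nat.card_pos.ne'⟩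
  have hS : Finite S := by
    refine Finite.of_injective (β := G → G → rootsOfUnity (Nat.card G) k)
      (fun c g h => ⟨value c.1 g h, (mem_rootsOfUnity _ _).2 (c.2 g h)⟩) fun c c' h => ?_
    exact Subtype.ext (ext_value fun g j =>
      congrArg Subtype.val (congrFun (congrFun h g) j))
  refine Finite.of_surjective (fun c : S => groupCohomology.H2π (unitsRep k G) c.1) fun γ => ?_
  obtain ⟨c, hc, rfl⟩ := exists_value_pow_eq_one γ
  exact ⟨⟨c, hc⟩, rfl⟩

end H2Units

/-! ### Factor sets and lifting projective representations to central extensions. -/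

namespace CentralCyclicExtension

variable {G : Type u} [Group G] (C : CentralCyclicExtension G)

theorem inl_mul_comm (z : C.Z) (e : C.E) : C.ext.inl z * e = e * C.ext.inl z :=
  (Subgroup.mem_center_iff.1 (C.central ⟨z, rfl⟩) e).symm

theorem exists_inl_eq (e : C.E) (h : C.ext.rightHom e = 1) : ∃ z, C.ext.inl z = e := by
  rw [← MonoidHom.mem_ker, ← C.ext.range_inl_eq_ker_rightHom] at h
  exact h

/-- The `Z`-valued cocycle of a section. -/
theorem exists_factorSet (s : C.ext.Section) :
    ∃ z : G → G → C.Z, (∀ g h, C.ext.inl (z g h) = s g * s h * (s (g * h))⁻¹) ∧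
      ∀ g h j, z (g * h) j * z g h = z h j * z g (h * j) := by
  choose z hz using fun g h => C.exists_inl_eq (s g * s h * (s (g * h))⁻¹) (by simp)
  refine ⟨z, hz, fun g h j => C.ext.inl_injective ?_⟩
  have h1 : ∀ g h, s g * s h = C.ext.inl (z g h) * s (g * h) := fun g h => by
    rw [hz, inv_mul_cancel_right]
  refine mul_right_cancel (b := s (g * h * j)) ?_
  calc C.ext.inl (z (g * h) j * z g h) * s (g * h * j)
      = C.ext.inl (z g h) * (C.ext.inl (z (g * h) j) * s (g * h * j)) := by
        rw [map_mul C.ext.inl, C.inl_mul_comm, mul_assoc]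
    _ = s g * (s h * s j) := by rw [← h1, ← mul_assoc, ← h1, mul_assoc]
    _ = C.ext.inl (z h j) * (C.ext.inl (z g (h * j)) * s (g * (h * j))) := by
        rw [← h1, h1 h j, ← mul_assoc, ← C.inl_mul_comm, mul_assoc]
    _ = C.ext.inl (z h j * z g (h * j)) * s (g * h * j) := by
        rw [map_mul C.ext.inl, mul_assoc, mul_assoc g h j]

/-- A map `R` on `G` that is multiplicative up to the central cocycle of an extension lifts to a
homomorphism on the extension. -/
theorem exists_hom_of_factorSet {A : Type*} [Group A] (f : C.Z →* A)
    (hf : ∀ z x, f z * x = x * f z) (s : C.ext.Section) (z : G → G → C.Z)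
    (hz : ∀ g h, C.ext.inl (z g h) = s g * s h * (s (g * h))⁻¹) (R : G → A)
    (hR : ∀ g h, R g * R h = f (z g h) * R (g * h)) :
    ∃ F : C.E →* A, (∀ x, F (C.ext.inl x) = f x) ∧
      ∀ e, ∃ x, F e = f x * R (C.ext.rightHom e) := by
  have h1 : ∀ g h, s g * s h = C.ext.inl (z g h) * s (g * h) := fun g h => by
    rw [hz, inv_mul_cancel_right]
  have hdec : ∀ e : C.E, ∃ x, C.ext.inl x * s (C.ext.rightHom e) = e := by
    intro e
    obtain ⟨x, hx⟩ := C.exists_inl_eq (e * (s (C.ext.rightHom e))⁻¹) (by simp)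
    exact ⟨x, by rw [hx, inv_mul_cancel_right]⟩
  choose ζ hζ using hdec
  have hζmul : ∀ e e', ζ (e * e') =
      ζ e * ζ e' * z (C.ext.rightHom e) (C.ext.rightHom e') := by
    intro e e'
    refine C.ext.inl_injective (mul_right_cancel (b := s (C.ext.rightHom (e * e'))) ?_)
    rw [hζ, map_mul C.ext.inl, map_mul C.ext.inl, map_mul C.ext.rightHom,
      mul_assoc _ (C.ext.inl (z _ _)), ← h1, mul_assoc, ← mul_assoc (C.ext.inl (ζ e')),
      C.inl_mul_comm (ζ e'), mul_assoc (s _), hζ, ← mul_assoc, hζ]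
  let F : C.E →* A := MonoidHom.mk' (fun e => f (ζ e) * R (C.ext.rightHom e)) fun e e' => by
    rw [hζmul, map_mul f, map_mul f, map_mul C.ext.rightHom, mul_assoc _ (f (z _ _)), ← hR,
      mul_assoc (f (ζ e)), mul_assoc (f (ζ e)), ← mul_assoc (f (ζ e')), hf (ζ e'), mul_assoc (R _)]
  refine ⟨F, fun x => ?_, fun e => ⟨ζ e, rfl⟩⟩
  -- The section need not send `1` to `1`; the corrections to `s 1` and `R 1` are both governed by
  -- `z 1 1`.
  have hR1 : R 1 = f (z 1 1) := mul_right_cancel (b := R 1) (by rw [hR, one_mul])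
  have hs1 : s 1 = C.ext.inl (z 1 1) := by rw [hz, one_mul, mul_inv_cancel_right]
  change f (ζ (C.ext.inl x)) * R (C.ext.rightHom (C.ext.inl x)) = f x
  rw [C.ext.rightHom_inl, hR1, ← map_mul f]
  congr 1
  refine C.ext.inl_injective ?_
  rw [map_mul C.ext.inl, ← hs1, ← C.ext.rightHom_inl x, hζ]

end CentralCyclicExtension

/-- A representation of a central extension `D`, whose kernel acts by a character `χ'`, can be
transported to a central extension `C` with a character `χ` of its kernel if the factor sets become
cohomologous in `k^×`. -/
theorem CentralCyclicExtension.exists_representation_of_cohomologous {k : Type u} [Field k]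
    {G : Type u} [Group G] (C D : CentralCyclicExtension G) (χ : C.Z →* kˣ) (χ' : D.Z →* kˣ)
    {W : Type u} [AddCommGroup W] [Module k W] (ρ : Representation k D.E W)
    (hρ : ∀ z, ρ (D.ext.inl z) = (χ' z : k) • LinearMap.id)
    (s : C.ext.Section) (z : G → G → C.Z)
    (hz : ∀ g h, C.ext.inl (z g h) = s g * s h * (s (g * h))⁻¹)
    (s' : D.ext.Section) (z' : G → G → D.Z)
    (hz' : ∀ g h, D.ext.inl (z' g h) = s' g * s' h * (s' (g * h))⁻¹)
    (b : G → kˣ) (hb : ∀ g h, χ' (z' g h) * b (g * h) = χ (z g h) * (b g * b h)) :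
    ∃ ρ' : Representation k C.E W, (∀ x, ρ' (C.ext.inl x) = (χ x : k) • LinearMap.id) ∧
      ∀ e e', C.ext.rightHom e = D.ext.rightHom e' → ∃ c : kˣ, ρ' e = (c : k) • ρ e' := by
  let sc : kˣ →* (Module.End k W)ˣ := Units.map (algebraMap k (Module.End k W)).toMonoidHom
  have hscv : ∀ x, (sc x : Module.End k W) = (x : k) • LinearMap.id := fun x =>
    Module.algebraMap_end_eq_smul_id k k W (x : k)
  have hsc : ∀ x A, sc x * A = A * sc x := fun x A =>
    Units.ext (Algebra.commutes (x : k) (A : Module.End k W))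
  clear_value sc
  let r : D.E →* (Module.End k W)ˣ := MonoidHom.toHomUnits ρ
  have hrv : ∀ x, (r x : Module.End k W) = ρ x := fun _ => rfl
  clear_value r
  have hrZ : ∀ x, r (D.ext.inl x) = sc (χ' x) := fun x =>
    Units.ext (by rw [hrv, hρ, hscv])
  -- Rescaling the lift at `g` by `(b g)⁻¹` changes its factor set from that of `D` to that of `C`.
  have hR : ∀ g h, sc (b g)⁻¹ * r (s' g) * (sc (b h)⁻¹ * r (s' h)) =
      sc (χ (z g h)) * (sc (b (g * h))⁻¹ * r (s' (g * h))) := by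
    intro g h
    have h1 : r (s' g) * r (s' h) = sc (χ' (z' g h)) * r (s' (g * h)) := by
      rw [← hrZ, hz', ← map_mul r, ← map_mul r, inv_mul_cancel_right]
    have h2 : (b g)⁻¹ * (b h)⁻¹ * χ' (z' g h) = χ (z g h) * (b (g * h))⁻¹ := by
      rw [eq_mul_inv_iff_mul_eq, mul_assoc, hb, ← mul_inv, mul_comm, mul_assoc, mul_inv_cancel,
        mul_one]
    have h3 : Commute (r (s' g)) (sc (b h)⁻¹) := (hsc _ _).symm
    rw [h3.mul_mul_mul_comm, h1, ← mul_assoc, ← mul_assoc, ← map_mul sc, ← map_mul sc, h2,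
      map_mul sc, mul_assoc]
  obtain ⟨F, hFZ, hF⟩ := C.exists_hom_of_factorSet (sc.comp χ) (fun _ _ => hsc _ _) s z hz _ hR
  refine ⟨(Units.coeHom (Module.End k W)).comp F, fun x => ?_, fun e e' he => ?_⟩
  · rw [MonoidHom.comp_apply, hFZ, MonoidHom.comp_apply, Units.coeHom_apply, hscv]
  obtain ⟨x, hx⟩ := hF e
  obtain ⟨y, hy⟩ := D.exists_inl_eq (s' (C.ext.rightHom e) * e'⁻¹) (by simp [he])
  refine ⟨χ x * (b (C.ext.rightHom e))⁻¹ * χ' y, ?_⟩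
  have h1 : r (s' (C.ext.rightHom e)) = sc (χ' y) * r e' := by
    rw [← hrZ, hy, ← map_mul r, inv_mul_cancel_right]
  rw [h1, ← mul_assoc, ← mul_assoc, MonoidHom.comp_apply, ← map_mul sc, ← map_mul sc] at hx
  rw [MonoidHom.comp_apply, hx, Units.coeHom_apply, Units.val_mul, hscv, hrv, smul_mul_assoc]
  rfl

/-- For a central cyclic extension `C` with a character of its kernel, there is a class `γ` such
that the projective representation attached to any datum of class `γ` lifts to a representation
of `C` on which the kernel acts by the character. -/
theorem CentralCyclicExtension.exists_class_representation {k : Type u} [Field k] {G : Type u}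
    [Group G] (C : CentralCyclicExtension G) (χ : C.Z →* kˣ) :
    ∃ γ : H2Units k G, ∀ T : TestDatum k G γ, ∃ ρ : Representation k C.E T.W,
      (∀ z, ρ (C.ext.inl z) = (χ z : k) • LinearMap.id) ∧
      ∀ e e', C.ext.rightHom e = T.ext.rightHom e' → ∃ c : kˣ, ρ e = (c : k) • T.ρ e' := by
  let s : C.ext.Section := ⟨Function.surjInv C.ext.rightHom_surjective,
    Function.rightInverse_surjInv _⟩
  obtain ⟨z, hz, hzc⟩ := C.exists_factorSet s
  -- The class `γ` is the pushforward along `χ` of the factor set of `C`.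
  let c := H2Units.mkCocycle (k := k) (fun g h => χ (z g h)) fun g h j => by
    rw [← map_mul, hzc, map_mul]
  refine ⟨groupCohomology.H2π (unitsRep k G) c, fun T => ?_⟩
  obtain ⟨s', c', hc', hγ⟩ := T.hasClass
  obtain ⟨z', hz', -⟩ := T.exists_factorSet s'
  have hval : ∀ g h, H2Units.value c' g h = (T.χ (z' g h) : kˣ) := fun g h =>
    congrArg (Additive.toMul (α := kˣ)) (hc' g h _ (hz' g h))
  obtain ⟨b, hb⟩ := (H2Units.H2π_eq_iff c' c).1 hγ
  refine C.exists_representation_of_cohomologous T.toCentralCyclicExtension χ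
    ((rootsOfUnity (Nat.card T.Z) k).subtype.comp T.χ.toMonoidHom) T.ρ T.scalar_eq s z hz s' z' hz'
    b fun g h => ?_
  have h1 := hb g h
  rw [hval] at h1
  exact h1

end

/-! ### Passing between central extensions, and the equivalences. -/

theorem Representation.power_eq_smul {k : Type u} [Field k] {G H : Type u} [Group G] [Group H]
    {W : Type u} [AddCommGroup W] [Module k W] (ρ : Representation k G W)
    (ρ' : Representation k H W) (m : ℕ) {g : G} {h : H} {c : k} (hc : ρ g = c • ρ' h) :
    ρ.power m g = c • ρ'.power m h :=
  LinearMap.ext fun w => funext fun i => congrArg (fun F : W →ₗ[k] W => F (w i)) hc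

/-- The descended action uses a chosen lift of `g`; a representation agreeing with `T.ρ` up to
scalars gives the same automorphism. -/
theorem TestDatum.projAction_act {k : Type u} [Field k] {G : Type u} [Group G] {γ : H2Units k G}
    (T : TestDatum k G γ) (m : ℕ) {H : Type u} [Group H] (ρ : Representation k H T.W) (h : H)
    (g : G) (hρ : ∀ e, T.ext.rightHom e = g → ∃ c : kˣ, ρ h = (c : k) • T.ρ e) :
    (T.projAction m).act g = (ProjDual.action (ρ.power m)).act h := by
  obtain ⟨c, hc⟩ := hρ _ (Function.surjInv_eq T.ext.rightHom_surjective g)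
  exact (ProjDual.action_act_eq_of_smul _ _ h _ c (Representation.power_eq_smul ρ T.ρ m hc)).symm

theorem TestDatum.exists_smul {k : Type u} [Field k] {G : Type u} [Group G] {γ : H2Units k G}
    (T : TestDatum k G γ) (e e' : T.E) (h : T.ext.rightHom e' = T.ext.rightHom e) :
    ∃ c : kˣ, T.ρ e = (c : k) • T.ρ e' := by
  obtain ⟨z, hz⟩ := T.exists_inl_eq (e * e'⁻¹) (by simp [h])
  refine ⟨T.χ z, ?_⟩
  have : e = T.ext.inl z * e' := by rw [hz, inv_mul_cancel_right]
  rw [this, map_mul, T.scalar_eq, smul_mul_assoc]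
  rfl

theorem CentralCyclicExtension.finite {G : Type u} [Group G] [Finite G]
    (C : CentralCyclicExtension G) : Finite C.E := by
  refine Finite.of_surjective
    (fun p : C.Z × G => C.ext.inl p.1 * Function.surjInv C.ext.rightHom_surjective p.2) fun e => ?_
  obtain ⟨z, hz⟩ := C.exists_inl_eq
    (e * (Function.surjInv C.ext.rightHom_surjective (C.ext.rightHom e))⁻¹)
    (by simp [Function.surjInv_eq])
  exact ⟨(z, C.ext.rightHom e), by dsimp only; rw [hz, inv_mul_cancel_right]⟩

theorem CentralCyclicExtension.exists_injective_character (k : Type u) [Field k] [IsAlgClosed k]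
    [CharZero k] {G : Type u} [Group G] (C : CentralCyclicExtension G) :
    ∃ χ : C.Z →* kˣ, Function.Injective χ := by
  have : NeZero (Nat.card C.Z) := ⟨Nat.card_pos.ne'⟩
  have hcard : Nat.card C.Z = Nat.card (rootsOfUnity (Nat.card C.Z) k) :=
    (HasEnoughRootsOfUnity.natCard_rootsOfUnity k _).symm
  let e : C.Z ≃* rootsOfUnity (Nat.card C.Z) k := mulEquivOfCyclicCardEq hcard
  exact ⟨(rootsOfUnity (Nat.card C.Z) k).subtype.comp e.toMonoidHom,
    Subtype.val_injective.comp e.injective⟩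

theorem DominatesEquivariantly.of_comp {S : Scheme.{u}} {G H : Type u} [Group G] [Group H]
    {X Y : Scheme.{u}} [X.Over S] [Y.Over S] {b : RightAction S G Y} {a : RightAction S G X}
    {b' : RightAction S H Y} (π : H →* G) (hπ : Function.Surjective π)
    (hb : ∀ h, b.act (π h) = b'.act h) (H : DominatesEquivariantly b' (a.comp π)) :
    DominatesEquivariantly b a := by
  obtain ⟨f, hf, hd, he⟩ := H
  refine ⟨f, hf, hd, fun g => ?_⟩
  obtain ⟨h, rfl⟩ := hπ g
  rw [hb]
  exact he h

theorem TestDatum.isUnirationalAction {k : Type u} [Field k] {G : Type u} [Group G]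
    {γ : H2Units k G} (T : TestDatum k G γ) {X : Scheme.{u}} [X.Over (Spec (.of k))]
    {a : RightAction (Spec (.of k)) G X} {m : ℕ} (h : DominatesEquivariantly (T.projAction m) a) :
    IsUnirationalAction (a.comp T.ext.rightHom) := by
  obtain ⟨f, hf, hd, he⟩ := h
  refine ⟨Fin m → T.W, inferInstance, inferInstance, inferInstance, T.ρ.power m, f, hf, hd,
    fun e => ?_⟩
  rw [← T.projAction_act m T.ρ e (T.ext.rightHom e) fun e' h => T.exists_smul e e' h]
  exact he _

/-- A faithful character of the kernel fixes `γ`; the datum's representation then lifts to the given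
extension and can replace `V`. -/
theorem IsProjectivelyUnirational.exists_dominatesEquivariantly {k : Type u} [Field k]
    [IsAlgClosed k] [CharZero k] {G : Type u} [Group G] [Finite G]
    (T : ∀ γ : H2Units k G, TestDatum k G γ) {X : Scheme.{u}} [X.Over (Spec (.of k))]
    [IsIntegral X] [LocallyOfFiniteType (X ↘ Spec (.of k))]
    {a : RightAction (Spec (.of k)) G X} (h : IsProjectivelyUnirational a) :
    ∃ (γ : H2Units k G) (m : ℕ), 0 < m ∧ DominatesEquivariantly ((T γ).projAction m) a := by
  obtain ⟨C, V, _, _, _, ρV, hV⟩ := h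
  obtain ⟨χ, hχ⟩ := C.exists_injective_character k
  obtain ⟨γ, hγ⟩ := C.exists_class_representation χ
  obtain ⟨ρ, hρZ, hρ⟩ := hγ (T γ)
  have := C.finite
  let ι := MonoidHom.ofInjective C.ext.inl_injective
  refine ⟨γ, _, Nat.succ_pos _, DominatesEquivariantly.of_comp C.ext.rightHom
    C.ext.rightHom_surjective (fun e => (T γ).projAction_act _ ρ e _ fun e' h => hρ e e' h.symm)
    (DominatesEquivariantly.of_scalar_representation ρ ρV C.ext.inl.range
      (χ.comp ι.symm.toMonoidHom) (hχ.comp ι.symm.injective) ?_ ?_ (a.comp C.ext.rightHom) ?_ hV)⟩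
  -- Being a scalar depends only on the image in `G`, as the two lifts differ by scalars; so the
  -- scalar subgroup is again the kernel.
  · rintro e ⟨c, hc⟩
    obtain ⟨e', he'⟩ := (T γ).ext.rightHom_surjective (C.ext.rightHom e)
    obtain ⟨c', hc'⟩ := hρ e e' he'.symm
    have hs : e' ∈ (T γ).ext.inl.range := by
      refine ((T γ).scalar_iff e').1 ⟨((c'⁻¹ : kˣ) : k) * c, ?_⟩
      rw [mul_smul, ← hc, hc', smul_smul, Units.inv_mul, one_smul]
    rw [(T γ).ext.range_inl_eq_ker_rightHom, MonoidHom.mem_ker, he'] at hs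
    rwa [C.ext.range_inl_eq_ker_rightHom, MonoidHom.mem_ker]
  · intro z
    obtain ⟨x, rfl⟩ := ι.surjective z
    refine (hρZ x).trans ?_
    rw [MonoidHom.comp_apply]
    simp
  · rintro _ ⟨x, rfl⟩
    change a.act (C.ext.rightHom (C.ext.inl x)) = _
    rw [C.ext.rightHom_inl, a.act_one]

theorem corollary7p2 {k : Type u} [Field k] [IsAlgClosed k] [CharZero k]
    {G : Type u} [Group G] [Finite G] (T : ∀ γ : H2Units k G, TestDatum k G γ) :
    Finite (H2Units k G) ∧
    ∀ (X : Scheme.{u}) [X.Over (Spec (CommRingCat.of k))] [IsIntegral X]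
      [Smooth (X ↘ Spec (CommRingCat.of k))]
      [Scheme.IsRationalOver (X ↘ Spec (CommRingCat.of k))]
      (_ : IsProjectiveOver k X) (a : RightAction (Spec (CommRingCat.of k)) G X),
      List.TFAE [
        IsProjectivelyUnirational a,
        ∃ γ : H2Units k G, IsUnirationalAction (a.comp (T γ).ext.rightHom),
        ∃ (γ : H2Units k G) (m : ℕ), 0 < m ∧
          DominatesEquivariantly ((T γ).projAction m) a] := by
  refine ⟨inferInstance, fun X _ _ _ _ _ a => ?_⟩
  tfae_have 1 → 3 := fun h => h.exists_dominatesEquivariantly T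
  tfae_have 3 → 2 := fun ⟨γ, _, _, h⟩ => ⟨γ, (T γ).isUnirationalAction h⟩
  tfae_have 2 → 1 := fun ⟨γ, h⟩ => ⟨(T γ).toCentralCyclicExtension, h⟩
  tfae_finish
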